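/- **Theorem 3.4 (Normality under Strong Assumption).** Let $\theta$ be a random input parameter with distribution $P$ (the belief distribution), let $\xi$ be the stochastic noise, with conditional law $\kappa_\theta$ given $\theta$ (in particular, $\kappa_\theta$ may be independent of $\theta$), let $h(\theta;\xi)$ be a real-valued measurable response, and let $H(\theta)=\mathbb E[h(\theta;\xi)\mid\theta]$. Let $0<\alpha<1$, and define $$v_\alpha=\inf\{t:\ \mathbb P(H(\theta)\le t)\ge\alpha\},\qquad c_\alpha=v_\alpha+\tfrac1{1-\alpha}\,\mathbb E\big[(H(\theta)-v_\alpha)^+\big].$$ *Nested estimators.* Let $\theta_1,\theta_2,\dots$ be i.i.d. with law $P$ and, given $\theta_i$, let $\xi_{i1},\xi_{i2},\dots$ be i.i.d. with law $\kappa_{\theta_i}$, the blocks $(\theta_i,(\xi_{ij})_j)$ being independent over $i$. Put $\widehat H_M(\theta_i)=\frac1M\sum_{j=1}^M h(\theta_i;\xi_{ij})$. Let $\widetilde v_\alpha$ be the $\lceil\alpha N\rceil$-th smallest of $\widehat H_M(\theta_1),\dots,\widehat H_M(\theta_N)$ (the $\alpha N$-th if $\alpha N$ is an integer), and $$\widetilde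 c_\alpha=\widetilde v_\alpha+\frac1{(1-\alpha)N}\sum_{i=1}^N\big(\widehat H_M(\theta_i)-\widetilde v_\alpha\big)^+ .$$ *Strong Assumption.* (i) $\mathbb E[h^2(\theta;\xi)\mid\theta]<\infty$ almost surely and $\mathbb E[h^2(\theta;\xi)]<\infty$. (ii) For every $M\ge1$, with $\xi_1,\dots,\xi_M$ i.i.d. of law $\kappa_\theta$ given $\theta$, the pair consisting of $H(\theta)$ and $\bar{\mathcal E}_M=\sqrt M\cdot\frac1M\sum_{j=1}^M\big(h(\theta;\xi_j)-H(\theta)\big)$ has a joint density $p_M(t,e)$ for which $\partial_t p_M(t,e)$ and $\partial_t^2p_M(t,e)$ exist at all $(t,e)$. (iii) There are nonnegative measurable functions $g_{0,M},g_{1,M},g_{2,M}$ with $p_M(t,e)\le g_{0,M}(e)$, $|\partial_tp_M(t,e)|\le g_{1,M}(e)$ and $|\partial_t^2p_M(t,e)|\le g_{2,M}(e)$ for all $(t,e)$, and $\sup_{M\ge1}\int_{\mathbb R}|e|^r g_{i,M}(e)\,de<\infty$ for $i=0,1,2$ and all $0\le r\le4$. Suppose that the Strong Assumption holds, and that $H(\theta)$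 has a density $f$ that is continuous at $v_\alpha$ with $f(v_\alpha)>0$. Put $$\sigma_v=\frac{\sqrt{\alpha(1-\alpha)}}{f(v_\alpha)},\qquad \sigma_c=\frac{\sqrt{\operatorname{Var}[(H(\theta)-v_\alpha)^+]}}{1-\alpha}.$$ Then, for all sequences of sample sizes $N=N_k\to\infty$ and $M=M_k\to\infty$, the condition $N=o(M^2)$, i.e. $\lim_{k\to\infty}N_k/M_k^2=0$, is necessary and sufficient for the two convergences in distribution $$\sqrt N\,(\widetilde v_\alpha-v_\alpha)\Rightarrow\sigma_v\,\mathcal N(0,1)\qquad\text{and}\qquad\sqrt N\,(\widetilde c_\alpha-c_\alpha)\Rightarrow\sigma_c\,\mathcal N(0,1)$$ to hold (both of them). -/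

import Mathlib

open MeasureTheory ProbabilityTheory Filter Topology

noncomputable section

namespace NestedRisk

variable {Θ Ξ Ω : Type*} [MeasurableSpace Θ] [MeasurableSpace Ξ] [MeasurableSpace Ω]

/-! ### VaR and CVaR of a random variable `H` on a probability space `(Θ, P)` -/

/-- The `α`-level value-at-risk of `H`: `inf {t | F t ≥ α}` with `F` the c.d.f. of `H` under `P`. -/
def VaR (P : Measure Θ) (H : Θ → ℝ) (α : ℝ) : ℝ :=
  sInf {t : ℝ | α ≤ P.real {x | H x ≤ t}}

/-- The `α`-level conditional value-at-risk of `H`: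
`v_α + (1 - α)⁻¹ * 𝔼[(H - v_α)⁺]`. -/
def CVaR (P : Measure Θ) (H : Θ → ℝ) (α : ℝ) : ℝ :=
  VaR P H α + 1 / (1 - α) * ∫ x, max (H x - VaR P H α) 0 ∂P

/-- `f` is a probability density function of `H` under `P`. -/
structure IsDensityOf (f : ℝ → ℝ) (P : Measure Θ) (H : Θ → ℝ) : Prop where
  measurable : Measurable f
  nonneg : ∀ t, 0 ≤ f t
  map_eq : P.map H = (volume : Measure ℝ).withDensity (fun t => ENNReal.ofReal (f t))

/-- The asymptotic standard deviation `√(α (1 - α)) / f(v_α)` of the VaR estimator. -/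
def sigmaV (P : Measure Θ) (H : Θ → ℝ) (f : ℝ → ℝ) (α : ℝ) : ℝ :=
  Real.sqrt (α * (1 - α)) / f (VaR P H α)

/-- The asymptotic standard deviation `√Var[(H - v_α)⁺] / (1 - α)` of the CVaR estimator. -/
def sigmaC (P : Measure Θ) (H : Θ → ℝ) (α : ℝ) : ℝ :=
  Real.sqrt (variance (fun x => max (H x - VaR P H α) 0) P) / (1 - α)

/-! ### The stochastic response

The input parameter `θ` has the belief distribution `P`; given `θ`, the noise `ξ` has law `κ θ`
(a constant kernel is the case where the law of `ξ` does not depend on `θ`). -/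

/-- The mean response `H(θ) = 𝔼_ξ[h(θ; ξ)]`. -/
def meanResponse (κ : Kernel Θ Ξ) (h : Θ → Ξ → ℝ) (θ : Θ) : ℝ := ∫ ξ, h θ ξ ∂(κ θ)

/-- The inner sample average `Ĥ_M(θ) = M⁻¹ ∑_{j < M} h(θ; ξ_j)`. -/
def sampleMean (h : Θ → Ξ → ℝ) (M : ℕ) (θ : Θ) (ξ : ℕ → Ξ) : ℝ :=
  (1 / (M : ℝ)) * ∑ j ∈ Finset.range M, h θ (ξ j)

/-- The normalized noise `√M * M⁻¹ ∑_{j < M} (h(θ; ξ_j) - H(θ))`. -/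
def normalizedNoise (κ : Kernel Θ Ξ) (h : Θ → Ξ → ℝ) (M : ℕ) (θ : Θ) (ξ : ℕ → Ξ) : ℝ :=
  Real.sqrt M * ((1 / (M : ℝ)) * ∑ j ∈ Finset.range M, (h θ (ξ j) - meanResponse κ h θ))

/-- The kernel sending `θ` to the law of an i.i.d. sequence with common law `κ θ`. -/
def iidKernel (κ : Kernel Θ Ξ) [IsMarkovKernel κ] : Kernel Θ (ℕ → Ξ) where
  toFun θ := Measure.infinitePi (fun _ : ℕ => κ θ)
  measurable' := by
    refine Measurable.measure_of_isPiSystem_of_isProbabilityMeasure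
      (S := squareCylinders (fun _ : ℕ => {s : Set Ξ | MeasurableSet s}))
      generateFrom_squareCylinders.symm
      (isPiSystem_squareCylinders (fun _ => MeasurableSpace.isPiSystem_measurableSet) (by simp)) ?_
    rintro _ ⟨s, t, ht, rfl⟩
    have ht' : ∀ i ∈ s, MeasurableSet (t i) := fun i _ => ht i (Set.mem_univ i)
    simp only [Measure.infinitePi_pi _ ht']
    exact Finset.measurable_prod _ fun i hi => κ.measurable_coe (ht' i hi)

instance (κ : Kernel Θ Ξ) [IsMarkovKernel κ] : IsMarkovKernel (iidKernel κ) :=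
  ⟨fun θ => inferInstanceAs (IsProbabilityMeasure (Measure.infinitePi (fun _ : ℕ => κ θ)))⟩

/-- The joint law of a scenario `θ` and of its inner noises `ξ_0, ξ_1, …`: `θ` has law `P`, and
given `θ` the noises are i.i.d. with law `κ θ`. -/
def scenarioLaw (P : Measure Θ) (κ : Kernel Θ Ξ) [IsMarkovKernel κ] : Measure (Θ × (ℕ → Ξ)) :=
  P ⊗ₘ iidKernel κ

/-- The Strong Assumption. -/
structure StrongAssumption (P : Measure Θ) (κ : Kernel Θ Ξ) [IsMarkovKernel κ]
    (h : Θ → Ξ → ℝ) : Prop where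
  /-- the conditional second moment of the response is finite with probability one -/
  conditional_second_moment : ∀ᵐ θ ∂P, ∫⁻ ξ, ENNReal.ofReal (h θ ξ ^ 2) ∂(κ θ) < ⊤
  /-- the second moment of the response is finite -/
  second_moment : ∫⁻ θ, ∫⁻ ξ, ENNReal.ofReal (h θ ξ ^ 2) ∂(κ θ) ∂P < ⊤
  /-- For every `M ≥ 1` the pair (mean response, normalized noise) has a joint density `p M`, twice
  differentiable in its first variable, and `p M` and its first two partial derivatives in this
  variable are dominated by functions `g 0 M`, `g 1 M`, `g 2 M` of the second variable alone, whose
  absolute moments of every order `r ∈ [0, 4]` are bounded uniformly in `M`. -/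
  joint_density : ∃ (p : ℕ → ℝ → ℝ → ℝ) (g : Fin 3 → ℕ → ℝ → ℝ),
    (∀ M, 1 ≤ M → Measurable (Function.uncurry (p M))) ∧
    (∀ M, 1 ≤ M → ∀ t e, 0 ≤ p M t e) ∧
    (∀ M, 1 ≤ M →
      (scenarioLaw P κ).map (fun z => (meanResponse κ h z.1, normalizedNoise κ h M z.1 z.2)) =
        (volume : Measure (ℝ × ℝ)).withDensity (fun q => ENNReal.ofReal (p M q.1 q.2))) ∧
    (∀ M, 1 ≤ M → ∀ t e, DifferentiableAt ℝ (fun s => p M s e) t ∧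
      DifferentiableAt ℝ (deriv (fun s => p M s e)) t) ∧
    (∀ i M, 1 ≤ M → Measurable (g i M) ∧ ∀ e, 0 ≤ g i M e) ∧
    (∀ M, 1 ≤ M → ∀ t e, p M t e ≤ g 0 M e ∧
      |deriv (fun s => p M s e) t| ≤ g 1 M e ∧
      |deriv (deriv (fun s => p M s e)) t| ≤ g 2 M e) ∧
    (∀ i, ∀ r : ℝ, 0 ≤ r → r ≤ 4 → ∃ C : ℝ, ∀ M, 1 ≤ M →
      ∫⁻ e, ENNReal.ofReal (|e| ^ r * g i M e) ≤ ENNReal.ofReal C)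

/-! ### Nested simulation -/

/-- `θ i` and `ξ i j` are the outer scenarios and inner noises of a nested simulation: the blocks
`(θ i, (ξ i j)_j)` are independent, and each of them has the law `scenarioLaw P κ`. -/
structure IsNestedSample (P : Measure Θ) (κ : Kernel Θ Ξ) [IsMarkovKernel κ] (μ : Measure Ω)
    (θ : ℕ → Ω → Θ) (ξ : ℕ → ℕ → Ω → Ξ) : Prop where
  measurable_scenario : ∀ i, Measurable (θ i)
  measurable_noise : ∀ i j, Measurable (ξ i j)
  indep : iIndepFun (fun i ω => (θ i ω, fun j => ξ i j ω)) μ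
  law : ∀ i, HasLaw (fun ω => (θ i ω, fun j => ξ i j ω)) (scenarioLaw P κ) μ

/-- The `k`-th smallest of `x 0, …, x (N - 1)`, for `1 ≤ k ≤ N`. -/
def orderStat {N : ℕ} (x : Fin N → ℝ) (k : ℕ) : ℝ :=
  if hk : k - 1 < N then x (Tuple.sort x ⟨k - 1, hk⟩) else 0

/-- VaR estimator from `N` values: the `⌈α N⌉`-th smallest one (the `α N`-th if `α N` is an
integer). -/
def varEstimator (α : ℝ) {N : ℕ} (x : Fin N → ℝ) : ℝ := orderStat x ⌈α * N⌉₊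

/-- CVaR estimator from `N` values. -/
def cvarEstimator (α : ℝ) {N : ℕ} (x : Fin N → ℝ) : ℝ :=
  varEstimator α x + 1 / ((1 - α) * N) * ∑ i, max (x i - varEstimator α x) 0

/-- The values `Ĥ_M(θ_i)`, `i < N`, of a nested simulation with `N` scenarios and `M` inner
samples per scenario. -/
def nestedMeans (h : Θ → Ξ → ℝ) (θ : ℕ → Ω → Θ) (ξ : ℕ → ℕ → Ω → Ξ) (N M : ℕ) (ω : Ω) :
    Fin N → ℝ :=
  fun i => sampleMean h M (θ i ω) (fun j => ξ i j ω)

/-- The nested VaR estimator. -/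
def nestedVaR (h : Θ → Ξ → ℝ) (θ : ℕ → Ω → Θ) (ξ : ℕ → ℕ → Ω → Ξ) (α : ℝ) (N M : ℕ) (ω : Ω) : ℝ :=
  varEstimator α (nestedMeans h θ ξ N M ω)

/-- The nested CVaR estimator. -/
def nestedCVaR (h : Θ → Ξ → ℝ) (θ : ℕ → Ω → Θ) (ξ : ℕ → ℕ → Ω → Ξ) (α : ℝ) (N M : ℕ) (ω : Ω) : ℝ :=
  cvarEstimator α (nestedMeans h θ ξ N M ω)

end NestedRisk

end

/-! Write `Ĥ_M = H + δ E` with `δ = M^(-1/2)` and `E` the normalized noise. For a kernel supported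
in the strip `|s - t| ≤ δ|e|`, replacing the joint density `p(s, e)` by `p(t, e)` costs one more
power of `δ` (`abs_integral_sub_le`). For the distribution function the main term is `-δ ∫ e p(t, e)
de`, which vanishes since the noise is conditionally centered: the bias is `O(1/M)`, uniformly in
`t`. For the expected excess over `v` the main term is `J/(2M)` with `J = ∫ e² p(v, e) de`. This `J`
does not depend on `M`, because the conditional variance of `E` does not, and it is positive because
`f(v) > 0`. Hence the excess bias has exact order `1/M` (`exists_bias_bounds`).

For the value-at-risk, `√N (ṽ - v) ≤ y` says that at least `αN` of the inner means are at most `v +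
y/√N`. After centering, this compares a normalized sum of indicators with a deterministic level,
which tends to `-f(v) y` when `√N/M → 0`. The sum is asymptotically that of the indicators of `H ≤
v`, so the central limit theorem applies.

For the conditional value-at-risk, `c̃` is the minimum of the convex Rockafellar–Uryasev objective
`G`, attained at `ṽ`. The subgradient of `G` at `v` gives `0 ≤ G(v) - c̃ ≤ |F_N(v) - α| |ṽ - v| / (1
- α)`, where `F_N` is the empirical distribution function of the inner means. This is
`o_p(N^(-1/2))` as soon as `√N (ṽ - v)` is tight. So `√N (c̃ - c)` is a centered i.i.d. sum, plus a
deterministic bias `a ≥ 0` of exact order `√N/M`, plus `o_p(1)`.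

If `N = o(M²)` the bias disappears and both limits follow. Conversely, the limit of `ṽ` supplies
tightness, and the limit of `c̃` forces `a → 0`, since a nonvanishing nonnegative translation would
change the limit law; thus `√N/M → 0`. -/

noncomputable section

namespace NestedRisk

set_option linter.unusedSectionVars false

variable {Θ Ξ Ω : Type*} [MeasurableSpace Θ] [MeasurableSpace Ξ] [MeasurableSpace Ω]

/-! ### Order statistics -/

/-- The number of entries of `x` that are at most `t`. -/
def countLE {N : ℕ} (x : Fin N → ℝ) (t : ℝ) : ℝ := ∑ i, Set.indicator (Set.Iic t) 1 (x i)

theorem countLE_eq_card {N : ℕ} (x : Fin N → ℝ) (t : ℝ) :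
    countLE x t = (Finset.univ.filter fun i => x i ≤ t).card := by
  simp [countLE, Set.indicator_apply]

/-- In the sorted tuple the entries at most `t` form an initial segment, and sorting does not change
their number. The bound `1 ≤ k` makes the zero-based index `k - 1` the intended one. -/
theorem orderStat_le_iff {N : ℕ} (x : Fin N → ℝ) {k : ℕ} (hk1 : 1 ≤ k) (hkN : k ≤ N) (t : ℝ) :
    orderStat x k ≤ t ↔ k ≤ (Finset.univ.filter fun i => x i ≤ t).card := by
  have hk : k - 1 < N := by omega
  have h1 := Tuple.lt_card_le_iff_apply_le_of_monotone (j := ⟨k - 1, hk⟩) (a := t)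
    (Tuple.monotone_sort x)
  have h2 : (Finset.univ.filter fun i => (x ∘ Tuple.sort x) i ≤ t).card =
      (Finset.univ.filter fun i => x i ≤ t).card := by
    refine Finset.card_bij (fun i _ => Tuple.sort x i) ?_ ?_ ?_
    · intro i hi; simpa using hi
    · intro i _ j _ hij; simpa using hij
    · intro i hi
      exact ⟨(Tuple.sort x).symm i, by simpa using hi, by simp⟩
  rw [orderStat, dif_pos hk]
  rw [← h2]
  simp only [Function.comp_apply] at h1 ⊢
  rw [← h1]
  omega

/-- Counts are integers, so the ceiling in the rank disappears. This turns every event about the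
sample quantile into an event about a sum of indicators. -/
theorem varEstimator_le_iff {α : ℝ} (hα0 : 0 < α) (hα1 : α < 1) {N : ℕ} (hN : 0 < N)
    (x : Fin N → ℝ) (t : ℝ) : varEstimator α x ≤ t ↔ α * N ≤ countLE x t := by
  have hN' : (0 : ℝ) < N := by exact_mod_cast hN
  rw [varEstimator, orderStat_le_iff, Nat.ceil_le, countLE_eq_card]
  · exact Nat.ceil_pos.2 (by positivity)
  · exact Nat.ceil_le.2 (by nlinarith)

/-- The default value of `orderStat`, needed because measurability is required at every sample size,
zero included. -/
theorem varEstimator_of_isEmpty (α : ℝ) (x : Fin 0 → ℝ) : varEstimator α x = 0 := by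
  simp [varEstimator, orderStat]

theorem measurable_countLE {N : ℕ} {x : Ω → Fin N → ℝ} (hx : ∀ i, Measurable fun ω => x ω i)
    (t : ℝ) : Measurable fun ω => countLE (x ω) t :=
  Finset.measurable_fun_sum _ fun i _ =>
    (measurable_const.indicator measurableSet_Iic).comp (hx i)

theorem measurable_varEstimator {α : ℝ} (hα0 : 0 < α) (hα1 : α < 1) {N : ℕ}
    {x : Ω → Fin N → ℝ} (hx : ∀ i, Measurable fun ω => x ω i) :
    Measurable fun ω => varEstimator α (x ω) := by
  rcases Nat.eq_zero_or_pos N with rfl | hN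
  · simp only [varEstimator_of_isEmpty]; exact measurable_const
  · refine measurable_of_Iic fun t => ?_
    have : (fun ω => varEstimator α (x ω)) ⁻¹' Set.Iic t = {ω | α * N ≤ countLE (x ω) t} := by
      ext ω; simp [varEstimator_le_iff hα0 hα1 hN]
    rw [this]
    exact measurableSet_le measurable_const (measurable_countLE hx t)

theorem measurable_cvarEstimator {α : ℝ} (hα0 : 0 < α) (hα1 : α < 1) {N : ℕ}
    {x : Ω → Fin N → ℝ} (hx : ∀ i, Measurable fun ω => x ω i) :
    Measurable fun ω => cvarEstimator α (x ω) := by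
  have h1 := measurable_varEstimator hα0 hα1 hx
  exact h1.add (measurable_const.mul (Finset.measurable_fun_sum _ fun i _ =>
    ((hx i).sub h1).max measurable_const))

/-! ### The Rockafellar–Uryasev objective -/

/-- The empirical Rockafellar–Uryasev objective, minimized by the empirical value-at-risk. -/
def empiricalObjective (α : ℝ) {N : ℕ} (x : Fin N → ℝ) (w : ℝ) : ℝ :=
  w + 1 / ((1 - α) * N) * ∑ i, max (x i - w) 0

/-- The objective is convex, and each `x i > v` contributes slope `-1` to the sum. Its right
derivative at `v` is therefore `1 - (1 - F_N(v))/(1 - α) = (F_N(v) - α)/(1 - α)`, with `F_N(v) =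
countLE x v / N`. -/
theorem empiricalObjective_subgradient {α : ℝ} (hα1 : α < 1) {N : ℕ} (hN : 0 < N)
    (x : Fin N → ℝ) (v w : ℝ) :
    empiricalObjective α x v + (countLE x v / N - α) / (1 - α) * (w - v) ≤
      empiricalObjective α x w := by
  have hN' : (0 : ℝ) < N := by exact_mod_cast hN
  have hα : 0 < 1 - α := by linarith
  have hsum : ∑ i, max (x i - v) 0 ≤ ∑ i, max (x i - w) 0 + (N - countLE x v) * (w - v) := by
    have : ((N : ℝ) - countLE x v) * (w - v) =
        ∑ i, (1 - Set.indicator (Set.Iic v) (1 : ℝ → ℝ) (x i)) * (w - v) := by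
      rw [← Finset.sum_mul, Finset.sum_sub_distrib]; simp [countLE]
    rw [this, ← Finset.sum_add_distrib]
    refine Finset.sum_le_sum fun i _ => ?_
    by_cases h : x i ≤ v
    · simp [h]
    · have h' : x i ∉ Set.Iic v := h
      simp only [Set.indicator_of_notMem h', sub_zero, one_mul]
      push Not at h
      rw [max_eq_left (by linarith : 0 ≤ x i - v)]
      linarith [le_max_left (x i - w) 0]
  have hc : 0 < 1 / ((1 - α) * N) := by positivity
  have := mul_le_mul_of_nonneg_left hsum hc.le
  have e : 1 / ((1 - α) * N) * ((N - countLE x v) * (w - v)) =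
      (w - v) - (countLE x v / N - α) / (1 - α) * (w - v) := by
    field_simp; ring
  rw [mul_add, e] at this
  unfold empiricalObjective
  linarith

/-- The right slope is nonnegative at the sample quantile `q` and nonpositive at every `u < q`, so
`q` is a minimizer. For `w < q` the right slope at `q` is of no use, and one compares with `u < q`
and lets `u` increase to `q`. -/
theorem cvarEstimator_le_empiricalObjective {α : ℝ} (hα0 : 0 < α) (hα1 : α < 1) {N : ℕ}
    (hN : 0 < N) (x : Fin N → ℝ) (w : ℝ) : cvarEstimator α x ≤ empiricalObjective α x w := by
  have hN' : (0 : ℝ) < N := by exact_mod_cast hN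
  have hα : 0 < 1 - α := by linarith
  change empiricalObjective α x (varEstimator α x) ≤ _
  set q := varEstimator α x with hq
  have hqle := (varEstimator_le_iff hα0 hα1 hN x q).1 le_rfl
  rcases le_or_gt q w with hw | hw
  · refine le_trans ?_ (empiricalObjective_subgradient hα1 hN x q w)
    have : 0 ≤ (countLE x q / N - α) / (1 - α) := by
      refine div_nonneg (sub_nonneg.2 ?_) hα.le
      rwa [le_div_iff₀ hN']
    nlinarith [mul_nonneg this (sub_nonneg.2 hw)]
  · -- the slopes of the objective to the left of `q` are at most zero
    have hmono : ∀ u, w ≤ u → u < q → empiricalObjective α x u ≤ empiricalObjective α x w := by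
      intro u hwu huq
      have h1 : ¬ α * N ≤ countLE x u := fun h =>
        absurd ((varEstimator_le_iff hα0 hα1 hN x u).2 h) (not_le.2 huq)
      have : (countLE x u / N - α) / (1 - α) ≤ 0 := by
        refine div_nonpos_of_nonpos_of_nonneg (sub_nonpos.2 ?_) hα.le
        rw [div_le_iff₀ hN']; linarith
      have h2 := empiricalObjective_subgradient hα1 hN x u w
      nlinarith [mul_nonneg (neg_nonneg.2 this) (sub_nonneg.2 hwu)]
    have hcont : Continuous (empiricalObjective α x) := by
      unfold empiricalObjective; fun_prop
    have : (𝓝[<] q).NeBot := inferInstance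
    refine le_of_tendsto (hcont.continuousWithinAt (s := Set.Iio q) (x := q)) ?_
    filter_upwards [Ico_mem_nhdsLT hw] with u hu using hmono u hu.1 hu.2

/-- Replacing the sample quantile by a fixed `v` costs only a product of two errors, each small when
`v` is the true quantile. -/
theorem le_cvarEstimator {α : ℝ} (hα1 : α < 1) {N : ℕ} (hN : 0 < N) (x : Fin N → ℝ) (v : ℝ) :
    empiricalObjective α x v -
      |(countLE x v / N - α) / (1 - α)| * |varEstimator α x - v| ≤ cvarEstimator α x := by
  refine le_trans ?_ (empiricalObjective_subgradient hα1 hN x v (varEstimator α x))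
  rw [← abs_mul]
  linarith [neg_abs_le ((countLE x v / N - α) / (1 - α) * (varEstimator α x - v))]

/-! ### Convergence in probability to zero -/

section InProbability

variable {ι Ω' : Type*} [MeasurableSpace Ω'] {μ : Measure Ω} [IsProbabilityMeasure μ]
  {μ' : Measure Ω'} [IsProbabilityMeasure μ'] {l : Filter ι} {X Y V : ι → Ω → ℝ} {Z : Ω' → ℝ}

theorem tendstoInMeasure_zero_iff :
    TendstoInMeasure μ Y l 0 ↔
      ∀ ε, 0 < ε → Tendsto (fun k => μ.real {ω | ε ≤ |Y k ω|}) l (𝓝 0) := by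
  simp [tendstoInMeasure_iff_measureReal_norm]

theorem tendsto_measureReal_zero_of_subset {s t : ι → Set Ω}
    (ht : Tendsto (fun k => μ.real (t k)) l (𝓝 0)) (hst : ∀ᶠ k in l, s k ⊆ t k) :
    Tendsto (fun k => μ.real (s k)) l (𝓝 0) :=
  squeeze_zero' (Eventually.of_forall fun _ => measureReal_nonneg)
    (hst.mono fun _ h => measureReal_mono h) ht

theorem tendstoInMeasure_zero_of_le (hY : TendstoInMeasure μ Y l 0)
    (h : ∀ᶠ k in l, ∀ ω, |X k ω| ≤ |Y k ω|) : TendstoInMeasure μ X l 0 := by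
  rw [tendstoInMeasure_zero_iff] at hY ⊢
  exact fun ε hε => tendsto_measureReal_zero_of_subset (hY ε hε)
    (h.mono fun k hk ω hω => le_trans hω (hk ω))

theorem tendstoInMeasure_zero_add (hX : TendstoInMeasure μ X l 0)
    (hY : TendstoInMeasure μ Y l 0) : TendstoInMeasure μ (fun k ω => X k ω + Y k ω) l 0 := by
  rw [tendstoInMeasure_zero_iff] at hX hY ⊢
  intro ε hε
  refine squeeze_zero (fun _ => measureReal_nonneg) (fun k => ?_)
    (by simpa using (hX (ε / 2) (half_pos hε)).add (hY (ε / 2) (half_pos hε)))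
  refine le_trans (measureReal_mono ?_) (measureReal_union_le _ _)
  intro ω hω
  by_contra hcon
  simp only [Set.mem_union, Set.mem_ofPred_eq, not_or, not_le] at hcon hω
  linarith [abs_add_le (X k ω) (Y k ω)]

theorem tendstoInMeasure_zero_const_mul (c : ℝ) (hX : TendstoInMeasure μ X l 0) :
    TendstoInMeasure μ (fun k ω => c * X k ω) l 0 := by
  rw [tendstoInMeasure_zero_iff] at hX ⊢
  intro ε hε
  refine tendsto_measureReal_zero_of_subset (hX (ε / (|c| + 1)) (by positivity))
    (Eventually.of_forall fun k ω hω => ?_)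
  simp only [Set.mem_ofPred_eq, abs_mul] at hω ⊢
  rw [div_le_iff₀ (by positivity)]
  nlinarith [abs_nonneg (X k ω)]

theorem tendstoInMeasure_zero_of_tendsto {a : ι → ℝ} (ha : Tendsto a l (𝓝 0)) :
    TendstoInMeasure μ (fun k _ => a k) l (0 : Ω → ℝ) := by
  rw [tendstoInMeasure_zero_iff]
  intro ε hε
  have : ∀ᶠ k in l, |a k| < ε := by
    have := (ha.abs).eventually_lt_const (u := ε) (by simpa using hε)
    exact this
  refine tendsto_nhds_of_eventually_eq (this.mono fun k hk => ?_)
  simp [not_le.2 hk]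

/-- Tightness: the closed sets `{K ≤ |x|}` decrease to the empty set, and the portmanteau theorem
bounds the limsup of their probabilities by the mass under the limit law. -/
theorem TendstoInDistribution.exists_measureReal_abs_ge_lt
    (h : TendstoInDistribution V l Z (fun _ => μ) μ') {ε : ℝ} (hε : 0 < ε) :
    ∃ K : ℝ, 0 < K ∧ ∀ᶠ k in l, μ.real {ω | K ≤ |V k ω|} < ε := by
  have : IsProbabilityMeasure (μ'.map Z) := Measure.isProbabilityMeasure_map h.aemeasurable_limit
  have hanti : Antitone fun K : ℕ => {x : ℝ | (K : ℝ) + 1 ≤ |x|} := by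
    intro a b hab x hx
    have : (a : ℝ) ≤ b := by exact_mod_cast hab
    simp only [Set.mem_ofPred_eq] at hx ⊢
    linarith
  have hclosed : ∀ K : ℝ, IsClosed {x : ℝ | K ≤ |x|} := fun K =>
    isClosed_le continuous_const continuous_abs
  have hlim := tendsto_measure_iInter_atTop (μ := μ'.map Z)
    (fun K : ℕ => ((hclosed ((K : ℝ) + 1)).measurableSet).nullMeasurableSet) hanti
    ⟨0, measure_ne_top _ _⟩
  have hempty : ⋂ K : ℕ, {x : ℝ | (K : ℝ) + 1 ≤ |x|} = ∅ := by
    ext x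
    simp only [Set.mem_iInter, Set.mem_ofPred_eq, Set.mem_empty_iff_false, iff_false, not_forall,
      not_le]
    obtain ⟨n, hn⟩ := exists_nat_gt |x|
    exact ⟨n, by linarith⟩
  rw [hempty, measure_empty] at hlim
  obtain ⟨K, hK⟩ := (hlim.eventually_lt_const (ENNReal.ofReal_pos.2 hε)).exists
  refine ⟨K + 1, by positivity, ?_⟩
  have hls := ProbabilityMeasure.limsup_measure_closed_le_of_tendsto h.tendsto
    (hclosed ((K : ℝ) + 1))
  have := eventually_lt_of_limsup_lt (lt_of_le_of_lt hls hK)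
  filter_upwards [this] with k hk
  have hk' : (μ.map (V k)) {x : ℝ | (K : ℝ) + 1 ≤ |x|} < ENNReal.ofReal ε := hk
  rw [Measure.map_apply_of_aemeasurable (h.forall_aemeasurable k)
    (hclosed _).measurableSet] at hk'
  exact (ENNReal.lt_ofReal_iff_toReal_lt (measure_ne_top _ _)).1 hk'

/-- A tight factor times a vanishing one: `|V| < K` and `|Y| < ε / K` give `|Y V| < ε`. -/
theorem tendstoInMeasure_zero_mul (hV : TendstoInDistribution V l Z (fun _ => μ) μ')
    (hY : TendstoInMeasure μ Y l 0) : TendstoInMeasure μ (fun k ω => Y k ω * V k ω) l 0 := by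
  rw [tendstoInMeasure_zero_iff] at hY ⊢
  intro ε hε
  rw [Metric.tendsto_nhds]
  intro η hη
  obtain ⟨K, hK0, hK⟩ := TendstoInDistribution.exists_measureReal_abs_ge_lt hV (half_pos hη)
  filter_upwards [hK, (hY (ε / K) (by positivity)).eventually_lt_const (half_pos hη)] with k h1 h2
  rw [Real.dist_eq, sub_zero, abs_of_nonneg measureReal_nonneg]
  refine lt_of_le_of_lt (le_trans (measureReal_mono ?_) (measureReal_union_le _ _))
    (by linarith : μ.real {ω | K ≤ |V k ω|} + μ.real {ω | ε / K ≤ |Y k ω|} < η)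
  intro ω hω
  by_contra hcon
  simp only [Set.mem_union, Set.mem_ofPred_eq, not_or, not_le, abs_mul] at hcon hω
  have := mul_lt_mul'' hcon.2 hcon.1 (abs_nonneg _) (abs_nonneg _)
  rw [div_mul_cancel₀ _ hK0.ne'] at this
  linarith

theorem TendstoInDistribution.add_of_tendstoInMeasure_zero [l.IsCountablyGenerated]
    (hX : TendstoInDistribution X l Z (fun _ => μ) μ') (hY : TendstoInMeasure μ Y l 0)
    (hV : ∀ k, AEMeasurable (V k) μ) (h : ∀ᶠ k in l, ∀ ω, V k ω = X k ω + Y k ω) :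
    TendstoInDistribution V l Z (fun _ => μ) μ' := by
  refine tendstoInDistribution_of_tendstoInMeasure_sub V Z hX ?_ hV
  refine tendstoInMeasure_zero_of_le hY (h.mono fun k hk ω => ?_)
  simp [hk ω]

/-- A sequence which crosses every level simultaneously with a sequence converging in distribution
converges to the same limit. -/
theorem tendstoInDistribution_of_levels [l.IsCountablyGenerated]
    (hX : TendstoInDistribution X l Z (fun _ => μ) μ') (hV : ∀ k, AEMeasurable (V k) μ)
    (h1 : ∀ y y', y < y' → Tendsto (fun k => μ.real {ω | V k ω ≤ y ∧ y' ≤ X k ω}) l (𝓝 0))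
    (h2 : ∀ y y', y < y' → Tendsto (fun k => μ.real {ω | X k ω ≤ y ∧ y' ≤ V k ω}) l (𝓝 0)) :
    TendstoInDistribution V l Z (fun _ => μ) μ' := by
  refine tendstoInDistribution_of_tendstoInMeasure_sub V Z hX ?_ hV
  rw [tendstoInMeasure_zero_iff]
  intro ε hε
  rw [Metric.tendsto_nhds]
  intro η hη
  obtain ⟨K, hK0, hK⟩ := TendstoInDistribution.exists_measureReal_abs_ge_lt hX (half_pos hη)
  -- If `|X| < K` and `|V - X| ≥ ε = 4d`, then `X` lies in one of finitely many cells `[j d, j d +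
  -- d)` and `V` is beyond `j d - d` or `j d + 2d`. So one of finitely many level-crossing events
  -- occurs.
  set d := ε / 4 with hd
  have hd0 : 0 < d := by positivity
  obtain ⟨n, hn⟩ := exists_nat_gt (K / d + 1)
  set J : Finset ℤ := Finset.Icc (-(n : ℤ)) n
  have hgrid : Tendsto (fun k => ∑ j ∈ J, (μ.real {ω | V k ω ≤ j * d - d ∧ j * d ≤ X k ω} +
      μ.real {ω | X k ω ≤ j * d + d ∧ j * d + 2 * d ≤ V k ω})) l (𝓝 0) := by
    have := tendsto_finsetSum J fun (j : ℤ) _ =>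
      (h1 (j * d - d) (j * d) (by linarith)).add (h2 (j * d + d) (j * d + 2 * d) (by linarith))
    simpa using this
  filter_upwards [hK, hgrid.eventually_lt_const (half_pos hη)] with k hk1 hk2
  rw [Real.dist_eq, sub_zero, abs_of_nonneg measureReal_nonneg]
  have hsub : {ω | ε ≤ |(V - X) k ω|} ⊆ {ω | K ≤ |X k ω|} ∪
      ⋃ j ∈ J, ({ω | V k ω ≤ j * d - d ∧ j * d ≤ X k ω} ∪
        {ω | X k ω ≤ j * d + d ∧ j * d + 2 * d ≤ V k ω}) := by
    intro ω hω
    simp only [Set.mem_ofPred_eq, Pi.sub_apply] at hω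
    by_cases hXK : K ≤ |X k ω|
    · exact Or.inl hXK
    refine Or.inr ?_
    push Not at hXK
    obtain ⟨hX1, hX2⟩ := abs_lt.1 hXK
    set j : ℤ := ⌊X k ω / d⌋ with hj
    have hj1 : (j : ℝ) * d ≤ X k ω := (le_div_iff₀ hd0).1 (Int.floor_le _)
    have hj2 : X k ω < j * d + d := by
      have := (div_lt_iff₀ hd0).1 (Int.lt_floor_add_one (X k ω / d))
      linarith
    have hKd : K < (n - 1) * d := by
      have : K / d < n - 1 := by linarith
      exact (div_lt_iff₀ hd0).1 this
    have hjJ : j ∈ J := by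
      rw [Finset.mem_Icc]
      constructor
      · have : (-(n : ℝ)) < j := by
          by_contra hc; push Not at hc; nlinarith
        exact_mod_cast this.le
      · have : (j : ℝ) < n := by
          by_contra hc; push Not at hc; nlinarith
        exact_mod_cast this.le
    refine Set.mem_biUnion hjJ ?_
    rcases le_abs.1 hω with h | h
    · exact Or.inr ⟨hj2.le, by linarith⟩
    · exact Or.inl ⟨by linarith, hj1⟩
  refine lt_of_le_of_lt (le_trans (measureReal_mono hsub) (measureReal_union_le _ _)) ?_
  have := le_trans (measureReal_biUnion_finset_le (μ := μ) J fun j : ℤ =>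
      ({ω | V k ω ≤ j * d - d ∧ j * d ≤ X k ω} ∪
        {ω | X k ω ≤ j * d + d ∧ j * d + 2 * d ≤ V k ω}))
    (Finset.sum_le_sum fun j _ => measureReal_union_le _ _)
  linarith

/-- If a sequence and its translates by nonnegative numbers have the same limit in distribution,
then the translations tend to zero. -/
theorem tendsto_zero_of_tendstoInDistribution_sub {a : ι → ℝ} (ha : ∀ᶠ k in l, 0 ≤ a k)
    (hX : TendstoInDistribution X l Z (fun _ => μ) μ')
    (hXa : TendstoInDistribution (fun k ω => X k ω - a k) l Z (fun _ => μ) μ') :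
    Tendsto a l (𝓝 0) := by
  have key : ∀ (g : ℝ → ℝ) (C : ℝ), Continuous g → (∀ x, |g x| ≤ C) → ∀ {W : ι → Ω → ℝ},
      TendstoInDistribution W l Z (fun _ => μ) μ' →
      Tendsto (fun k => ∫ ω, g (W k ω) ∂μ) l (𝓝 (∫ ω, g (Z ω) ∂μ')) := by
    intro g C hg hC W hW
    have := ProbabilityMeasure.tendsto_iff_forall_integral_tendsto.1 hW.tendsto
      (BoundedContinuousFunction.ofNormedAddCommGroup g hg C hC)
    simp only [ProbabilityMeasure.coe_mk, BoundedContinuousFunction.coe_ofNormedAddCommGroup]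
      at this
    rw [integral_map hW.aemeasurable_limit hg.aestronglyMeasurable] at this
    refine this.congr fun k => ?_
    rw [integral_map (hW.forall_aemeasurable k) hg.aestronglyMeasurable]
  have hbd : ∀ x, |Real.arctan x| ≤ Real.pi / 2 := fun x =>
    abs_le.2 ⟨(Real.neg_pi_div_two_lt_arctan x).le, (Real.arctan_lt_pi_div_two x).le⟩
  have hint : ∀ {W : Ω → ℝ}, AEMeasurable W μ → Integrable (fun ω => Real.arctan (W ω)) μ := by
    intro W hW
    exact Integrable.of_bound (Real.continuous_arctan.measurable.comp_aemeasurable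
      hW).aestronglyMeasurable (Real.pi / 2) (ae_of_all _ fun ω => hbd _)
  have hint' : ∀ {W : Ω' → ℝ}, AEMeasurable W μ' → Integrable (fun ω => Real.arctan (W ω)) μ' := by
    intro W hW
    exact Integrable.of_bound (Real.continuous_arctan.measurable.comp_aemeasurable
      hW).aestronglyMeasurable (Real.pi / 2) (ae_of_all _ fun ω => hbd _)
  rw [Metric.tendsto_nhds]
  intro ε hε
  have hZ := hX.aemeasurable_limit
  -- The test function `arctan` is bounded and strictly increasing. By `t1` the translation by `a k`
  -- changes its expectation by `o(1)`, whereas by `t2` the translation by `ε` changes it by an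
  -- amount with a positive limit; monotonicity then excludes `a k ≥ ε`.
  have t1 := (key _ _ Real.continuous_arctan hbd hX).sub (key _ _ Real.continuous_arctan hbd hXa)
  have t2 := (key _ _ Real.continuous_arctan hbd hX).sub
    (key (fun x => Real.arctan (x - ε)) _ (by fun_prop) (fun x => hbd _) hX)
  rw [sub_self] at t1
  have hpos : 0 < ∫ ω, Real.arctan (Z ω) ∂μ' - ∫ ω, Real.arctan (Z ω - ε) ∂μ' := by
    rw [← integral_sub (hint' hZ) (hint' (hZ.sub_const ε))]
    refine (integral_pos_iff_support_of_nonneg (fun ω => ?_)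
      ((hint' hZ).sub (hint' (hZ.sub_const ε)))).2 ?_
    · exact sub_nonneg.2 (Real.arctan_strictMono.monotone (by linarith))
    · have : Function.support (fun ω => Real.arctan (Z ω) - Real.arctan (Z ω - ε)) =
          Set.univ := by
        ext ω
        simp only [Function.mem_support, Set.mem_univ, iff_true]
        exact (sub_pos.2 (Real.arctan_strictMono (by linarith))).ne'
      change 0 < μ' (Function.support fun ω => Real.arctan (Z ω) - Real.arctan (Z ω - ε))
      rw [this]; simp
  have t3 := t2.sub t1
  rw [sub_zero] at t3
  filter_upwards [ha, t3.eventually_const_lt hpos] with k hk0 hk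
  rw [Real.dist_eq, sub_zero, abs_of_nonneg hk0]
  by_contra hcon
  push Not at hcon
  have hle : ∫ ω, Real.arctan (X k ω - a k) ∂μ ≤ ∫ ω, Real.arctan (X k ω - ε) ∂μ :=
    integral_mono (hint ((hX.forall_aemeasurable k).sub_const _))
      (hint ((hX.forall_aemeasurable k).sub_const _))
      fun ω => Real.arctan_strictMono.monotone (by linarith)
  linarith

end InProbability

/-! ### Normalized sums over an i.i.d. sample -/

section Sample

variable {S : Type*} [MeasurableSpace S] {Q : Measure S} [IsProbabilityMeasure Q]
  {μ : Measure Ω} [IsProbabilityMeasure μ] {ζ : ℕ → Ω → S}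

/-- The centered and normalized sum `N^(-1/2) * ∑ i < N, (φ (ζ i) - ∫ φ ∂Q)`. -/
def normalizedSum (Q : Measure S) (ζ : ℕ → Ω → S) (N : ℕ) (φ : S → ℝ) (ω : Ω) : ℝ :=
  (Real.sqrt N)⁻¹ * (∑ i ∈ Finset.range N, φ (ζ i ω) - N * ∫ z, φ z ∂Q)

theorem normalizedSum_sub {φ ψ : S → ℝ} (hφ : Integrable φ Q) (hψ : Integrable ψ Q) (N : ℕ)
    (ω : Ω) : normalizedSum Q ζ N (fun z => φ z - ψ z) ω =
      normalizedSum Q ζ N φ ω - normalizedSum Q ζ N ψ ω := by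
  simp only [normalizedSum, integral_sub hφ hψ, Finset.sum_sub_distrib]
  ring

theorem normalizedSum_const_mul (c : ℝ) (φ : S → ℝ) (N : ℕ) (ω : Ω) :
    normalizedSum Q ζ N (fun z => c * φ z) ω = c * normalizedSum Q ζ N φ ω := by
  simp only [normalizedSum, integral_const_mul, ← Finset.mul_sum]
  ring

theorem sum_eq_normalizedSum {N : ℕ} (hN : 0 < N) (φ : S → ℝ) (ω : Ω) :
    ∑ i ∈ Finset.range N, φ (ζ i ω) =
      Real.sqrt N * normalizedSum Q ζ N φ ω + N * ∫ z, φ z ∂Q := by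
  have hs : Real.sqrt N ≠ 0 := (Real.sqrt_pos.2 (by exact_mod_cast hN)).ne'
  rw [normalizedSum, mul_inv_cancel_left₀ hs]
  ring

theorem measurable_normalizedSum (hm : ∀ i, Measurable (ζ i)) {φ : S → ℝ} (hφ : Measurable φ)
    (N : ℕ) : Measurable (normalizedSum Q ζ N φ) :=
  ((Finset.measurable_fun_sum _ fun i _ => hφ.comp (hm i)).sub measurable_const).const_mul _

theorem memLp_normalizedSum (hm : ∀ i, Measurable (ζ i)) (hlaw : ∀ i, HasLaw (ζ i) Q μ)
    {φ : S → ℝ} (hφ2 : MemLp φ 2 Q) (N : ℕ) : MemLp (normalizedSum Q ζ N φ) 2 μ := by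
  have hsum : MemLp (fun ω => ∑ i ∈ Finset.range N, φ (ζ i ω)) 2 μ :=
    memLp_finsetSum _ fun i _ => hφ2.comp_measurePreserving ((hlaw i).measurePreserving (hm i))
  exact (hsum.sub (memLp_const (N * ∫ z, φ z ∂Q))).const_mul _

theorem integral_normalizedSum (hm : ∀ i, Measurable (ζ i)) (hlaw : ∀ i, HasLaw (ζ i) Q μ)
    {φ : S → ℝ} (hφ2 : MemLp φ 2 Q) (N : ℕ) : ∫ ω, normalizedSum Q ζ N φ ω ∂μ = 0 := by
  have hint : ∀ i, ∫ ω, φ (ζ i ω) ∂μ = ∫ z, φ z ∂Q := fun i =>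
    (hlaw i).integral_comp hφ2.aestronglyMeasurable
  have hmem : ∀ i, Integrable (fun ω => φ (ζ i ω)) μ := fun i =>
    (hφ2.comp_measurePreserving ((hlaw i).measurePreserving (hm i))).integrable one_le_two
  simp only [normalizedSum]
  rw [integral_const_mul, integral_sub (integrable_finsetSum _ fun i _ => hmem i)
    (integrable_const _), integral_finsetSum _ fun i _ => hmem i]
  simp [hint]

theorem integral_normalizedSum_sq (hm : ∀ i, Measurable (ζ i)) (hind : iIndepFun ζ μ)
    (hlaw : ∀ i, HasLaw (ζ i) Q μ) {φ : S → ℝ} (hφ : Measurable φ) (hφ2 : MemLp φ 2 Q) {N : ℕ}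
    (hN : 0 < N) : ∫ ω, normalizedSum Q ζ N φ ω ^ 2 ∂μ = variance φ Q := by
  have hN' : (0 : ℝ) < N := by exact_mod_cast hN
  have hmem : ∀ i, MemLp (φ ∘ ζ i) 2 μ := fun i =>
    hφ2.comp_measurePreserving ((hlaw i).measurePreserving (hm i))
  have hvar : ∀ i, variance (φ ∘ ζ i) μ = variance φ Q := fun i => by
    rw [← (hlaw i).map_eq, variance_map hφ.aemeasurable (hm i).aemeasurable]
  rw [← variance_of_integral_eq_zero (measurable_normalizedSum hm hφ N).aemeasurable
    (integral_normalizedSum hm hlaw hφ2 N)]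
  have hY : normalizedSum Q ζ N φ = fun ω => (Real.sqrt N)⁻¹ *
      ((∑ i ∈ Finset.range N, φ ∘ ζ i) ω - N * ∫ z, φ z ∂Q) := by
    ext ω; simp [normalizedSum]
  rw [hY, variance_const_mul, variance_sub_const
    (memLp_finsetSum' _ fun i _ => hmem i).aestronglyMeasurable,
    IndepFun.variance_sum (fun i _ => hmem i)]
  · simp only [hvar, Finset.sum_const, Finset.card_range, nsmul_eq_mul, inv_pow,
      Real.sq_sqrt hN'.le]
    field_simp
  · intro i _ j _ hij
    exact (hind.indepFun hij).comp hφ hφ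

/-- Chebyshev's inequality with a bound free of `N`, so that the summand may vary with the sample
size. -/
theorem measureReal_abs_normalizedSum_ge_le (hm : ∀ i, Measurable (ζ i)) (hind : iIndepFun ζ μ)
    (hlaw : ∀ i, HasLaw (ζ i) Q μ) {φ : S → ℝ} (hφ : Measurable φ) (hφ2 : MemLp φ 2 Q) (N : ℕ)
    {ε : ℝ} (hε : 0 < ε) :
    μ.real {ω | ε ≤ |normalizedSum Q ζ N φ ω|} ≤ (∫ z, φ z ^ 2 ∂Q) / ε ^ 2 := by
  have hQ : 0 ≤ ∫ z, φ z ^ 2 ∂Q := integral_nonneg fun z => sq_nonneg _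
  rcases Nat.eq_zero_or_pos N with rfl | hN
  · have : {ω | ε ≤ |normalizedSum Q ζ 0 φ ω|} = ∅ := by
      ext ω; simp [normalizedSum, not_le.2 hε]
    rw [this]; simp only [measureReal_empty]; positivity
  have hcheb := meas_ge_le_variance_div_sq (memLp_normalizedSum hm hlaw hφ2 N) hε
  rw [variance_of_integral_eq_zero (measurable_normalizedSum hm hφ N).aemeasurable
    (integral_normalizedSum hm hlaw hφ2 N), integral_normalizedSum_sq hm hind hlaw hφ hφ2 hN,
    integral_normalizedSum hm hlaw hφ2 N] at hcheb
  simp only [sub_zero] at hcheb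
  refine ENNReal.toReal_le_of_le_ofReal (by positivity)
    (hcheb.trans (ENNReal.ofReal_le_ofReal ?_))
  gcongr
  exact variance_le_expectation_sq hφ.aestronglyMeasurable

/-- Each `φ k` is deterministic, so convergence to zero in mean square suffices; no uniformity over
a class of functions is involved. -/
theorem tendstoInMeasure_normalizedSum {ι : Type*} {l : Filter ι} (hm : ∀ i, Measurable (ζ i))
    (hind : iIndepFun ζ μ) (hlaw : ∀ i, HasLaw (ζ i) Q μ) (N : ι → ℕ) {φ : ι → S → ℝ}
    (hφ : ∀ k, Measurable (φ k)) (hφ2 : ∀ᶠ k in l, MemLp (φ k) 2 Q)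
    (hlim : Tendsto (fun k => ∫ z, φ k z ^ 2 ∂Q) l (𝓝 0)) :
    TendstoInMeasure μ (fun k => normalizedSum Q ζ (N k) (φ k)) l 0 := by
  rw [tendstoInMeasure_zero_iff]
  intro ε hε
  refine squeeze_zero' (Eventually.of_forall fun _ => measureReal_nonneg)
    (hφ2.mono fun k hk => measureReal_abs_normalizedSum_ge_le hm hind hlaw (hφ k) hk (N k) hε) ?_
  simpa using hlim.div_const (ε ^ 2)

theorem tendstoInDistribution_normalizedSum {ι : Type*} {l : Filter ι}
    (hm : ∀ i, Measurable (ζ i)) (hind : iIndepFun ζ μ) (hlaw : ∀ i, HasLaw (ζ i) Q μ)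
    {N : ι → ℕ} (hN : Tendsto N l atTop) {φ : S → ℝ} (hφ : Measurable φ) (hφ2 : MemLp φ 2 Q) :
    TendstoInDistribution (fun k => normalizedSum Q ζ (N k) φ) l
      (fun z : ℝ => Real.sqrt (variance φ Q) * z) (fun _ => μ) (gaussianReal 0 1) := by
  have hvar : variance (φ ∘ ζ 0) μ = variance φ Q := by
    rw [← (hlaw 0).map_eq, variance_map hφ.aemeasurable (hm 0).aemeasurable]
  have hint : ∫ ω, φ (ζ 0 ω) ∂μ = ∫ z, φ z ∂Q :=
    (hlaw 0).integral_comp hφ.aestronglyMeasurable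
  have hY : HasLaw (fun z : ℝ => Real.sqrt (variance φ Q) * z)
      (gaussianReal 0 (variance (φ ∘ ζ 0) μ).toNNReal) (gaussianReal 0 1) := by
    refine ⟨by fun_prop, ?_⟩
    rw [gaussianReal_map_const_mul, hvar]
    congr 1
    · simp
    · ext
      simp [Real.sq_sqrt (variance_nonneg φ Q), variance_nonneg φ Q]
  have hclt := tendstoInDistribution_inv_sqrt_mul_sum_sub (X := fun i => φ ∘ ζ i) hY
    (hφ2.comp_measurePreserving ((hlaw 0).measurePreserving (hm 0)))
    (hind.comp (fun _ => φ) fun _ => hφ)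
    (fun i => ((hlaw i).identDistrib (hlaw 0)).comp hφ)
  refine ⟨fun k => (measurable_normalizedSum hm hφ _).aemeasurable, by fun_prop, ?_⟩
  refine (hclt.tendsto.comp hN).congr fun k => ?_
  simp only [Function.comp_apply, hint]
  rfl

end Sample

/-! ### Perturbation kernels -/

/-- The change of the indicator of `(-∞, t]` under a shift of the argument by `δ * e`. -/
def indicatorShift (δ t : ℝ) (q : ℝ × ℝ) : ℝ :=
  (Set.Iic t).indicator 1 (q.1 + δ * q.2) - (Set.Iic t).indicator 1 q.1

/-- The second-order part of the change of `s ↦ (s - t)⁺` under a shift by `δ * e`. -/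
def posPartShift (δ t : ℝ) (q : ℝ × ℝ) : ℝ :=
  max (q.1 + δ * q.2 - t) 0 - max (q.1 - t) 0 - δ * q.2 * (Set.Ioi t).indicator 1 q.1

theorem measurable_indicatorShift (δ t : ℝ) : Measurable (indicatorShift δ t) := by
  have h : Measurable ((Set.Iic t).indicator (1 : ℝ → ℝ)) :=
    measurable_one.indicator measurableSet_Iic
  exact (h.comp (by fun_prop)).sub (h.comp measurable_fst)

theorem measurable_posPartShift (δ t : ℝ) : Measurable (posPartShift δ t) := by
  have h : Measurable ((Set.Ioi t).indicator (1 : ℝ → ℝ)) :=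
    measurable_one.indicator measurableSet_Ioi
  have h' : Measurable fun q : ℝ × ℝ => (Set.Ioi t).indicator (1 : ℝ → ℝ) q.1 :=
    h.comp measurable_fst
  unfold posPartShift
  exact Measurable.sub (by fun_prop) (Measurable.mul (by fun_prop) h')

theorem indicatorShift_of_nonneg {δ t e : ℝ} (h : 0 ≤ δ * e) (s : ℝ) :
    indicatorShift δ t (s, e) = (Set.Ioc (t - δ * e) t).indicator (fun _ => -1) s := by
  simp only [indicatorShift, Set.indicator_apply, Set.mem_Iic, Set.mem_Ioc, Pi.one_apply]
  grind

theorem indicatorShift_of_nonpos {δ t e : ℝ} (h : δ * e ≤ 0) (s : ℝ) :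
    indicatorShift δ t (s, e) = (Set.Ioc t (t - δ * e)).indicator (fun _ => 1) s := by
  simp only [indicatorShift, Set.indicator_apply, Set.mem_Iic, Set.mem_Ioc, Pi.one_apply]
  grind

theorem posPartShift_of_nonneg {δ t e : ℝ} (h : 0 ≤ δ * e) (s : ℝ) :
    posPartShift δ t (s, e) =
      (Set.Ioc (t - δ * e) t).indicator (fun s => s - (t - δ * e)) s := by
  simp only [posPartShift, Set.indicator_apply, Set.mem_Ioi, Set.mem_Ioc, Pi.one_apply]
  grind

theorem posPartShift_of_nonpos {δ t e : ℝ} (h : δ * e ≤ 0) (s : ℝ) :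
    posPartShift δ t (s, e) =
      (Set.Ioc t (t - δ * e)).indicator (fun s => (t - δ * e) - s) s := by
  simp only [posPartShift, Set.indicator_apply, Set.mem_Ioi, Set.mem_Ioc, Pi.one_apply]
  grind

/-- For fixed `e` the kernel is `∓1` on the interval between `t` and `t - δ e`, which the shift
carries across `t`. -/
theorem integral_indicatorShift (δ t e : ℝ) : ∫ s, indicatorShift δ t (s, e) = -(δ * e) := by
  rcases le_total 0 (δ * e) with h | h
  · simp_rw [indicatorShift_of_nonneg h]
    rw [integral_indicator measurableSet_Ioc]
    simp [h]
  · simp_rw [indicatorShift_of_nonpos h]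
    rw [integral_indicator measurableSet_Ioc]
    simp [h]

/-- For fixed `e` the graph is a right triangle with both legs of length `|δ e|`. -/
theorem integral_posPartShift (δ t e : ℝ) :
    ∫ s, posPartShift δ t (s, e) = (δ * e) ^ 2 / 2 := by
  rcases le_total 0 (δ * e) with h | h
  · simp_rw [posPartShift_of_nonneg h]
    rw [integral_indicator measurableSet_Ioc,
      ← intervalIntegral.integral_of_le (by linarith)]
    simp [integral_id]; ring
  · simp_rw [posPartShift_of_nonpos h]
    rw [integral_indicator measurableSet_Ioc,
      ← intervalIntegral.integral_of_le (by linarith),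
      intervalIntegral.integral_sub (by simp) (by simp)]
    simp only [intervalIntegral.integral_const, integral_id, smul_eq_mul]; ring

theorem abs_indicatorShift_le (δ t : ℝ) (q : ℝ × ℝ) : |indicatorShift δ t q| ≤ 1 := by
  simp only [indicatorShift, Set.indicator_apply, Pi.one_apply]
  split_ifs <;> norm_num

theorem abs_posPartShift_le (δ t : ℝ) (q : ℝ × ℝ) : |posPartShift δ t q| ≤ |δ * q.2| := by
  obtain ⟨s, e⟩ := q
  simp only [posPartShift, Set.indicator_apply, Set.mem_Ioi, Pi.one_apply]
  grind

theorem posPartShift_nonneg (δ t : ℝ) (q : ℝ × ℝ) : 0 ≤ posPartShift δ t q := by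
  obtain ⟨s, e⟩ := q
  rcases le_total 0 (δ * e) with h | h
  · rw [posPartShift_of_nonneg h]
    exact Set.indicator_nonneg (fun s hs => sub_nonneg.2 hs.1.le) _
  · rw [posPartShift_of_nonpos h]
    exact Set.indicator_nonneg (fun s hs => sub_nonneg.2 hs.2) _

theorem indicatorShift_eq_zero {δ t : ℝ} {q : ℝ × ℝ} (h : |δ * q.2| < |q.1 - t|) :
    indicatorShift δ t q = 0 := by
  obtain ⟨s, e⟩ := q
  simp only [indicatorShift, Set.indicator_apply, Set.mem_Iic, Pi.one_apply] at h ⊢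
  grind

theorem posPartShift_eq_zero {δ t : ℝ} {q : ℝ × ℝ} (h : |δ * q.2| < |q.1 - t|) :
    posPartShift δ t q = 0 := by
  obtain ⟨s, e⟩ := q
  simp only [posPartShift, Set.indicator_apply, Set.mem_Ioi, Pi.one_apply] at h ⊢
  grind

/-! ### Joint densities with integrable bounds -/

/-- A density `p` on the plane, differentiable in its first variable, which together with its
partial derivative is dominated by functions of the second variable with four moments. -/
structure IsDominatedDensity (p : ℝ → ℝ → ℝ) (g₀ g₁ : ℝ → ℝ) : Prop where
  measurable : Measurable (Function.uncurry p)
  nonneg : ∀ t e, 0 ≤ p t e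
  differentiable : ∀ e, Differentiable ℝ fun s => p s e
  le : ∀ t e, p t e ≤ g₀ e
  abs_deriv_le : ∀ t e, |deriv (fun s => p s e) t| ≤ g₁ e
  integrable_pow₀ : ∀ n ≤ 4, Integrable fun e => |e| ^ n * g₀ e
  integrable_pow₁ : ∀ n ≤ 4, Integrable fun e => |e| ^ n * g₁ e

namespace IsDominatedDensity

variable {p : ℝ → ℝ → ℝ} {g₀ g₁ : ℝ → ℝ}

theorem deriv_bound_nonneg (hp : IsDominatedDensity p g₀ g₁) (e : ℝ) : 0 ≤ g₁ e :=
  (abs_nonneg _).trans (hp.abs_deriv_le 0 e)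

theorem measurable_right (hp : IsDominatedDensity p g₀ g₁) (t : ℝ) : Measurable (p t) :=
  hp.measurable.comp (measurable_const.prodMk measurable_id)

theorem abs_sub_le (hp : IsDominatedDensity p g₀ g₁) (s t e : ℝ) :
    |p s e - p t e| ≤ g₁ e * |s - t| := by
  have := Convex.norm_image_sub_le_of_norm_deriv_le (f := fun s => p s e) (s := Set.univ)
    (x := t) (y := s) (C := g₁ e) (fun x _ => hp.differentiable e x)
    (fun x _ => hp.abs_deriv_le x e) convex_univ trivial trivial
  simpa using this

/-- The law on the plane with density `p`. -/
def law (p : ℝ → ℝ → ℝ) : Measure (ℝ × ℝ) :=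
  (volume : Measure (ℝ × ℝ)).withDensity (fun q => ENNReal.ofReal (p q.1 q.2))

theorem measurable_ofReal (hp : IsDominatedDensity p g₀ g₁) :
    Measurable fun q : ℝ × ℝ => ENNReal.ofReal (p q.1 q.2) :=
  hp.measurable.ennreal_ofReal

theorem integral_law (hp : IsDominatedDensity p g₀ g₁) (K : ℝ × ℝ → ℝ) :
    ∫ q, K q ∂(law p) = ∫ q : ℝ × ℝ, K q * p q.1 q.2 := by
  rw [law, integral_withDensity_eq_integral_toReal_smul hp.measurable_ofReal
    (ae_of_all _ fun _ => ENNReal.ofReal_lt_top)]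
  refine integral_congr_ae (ae_of_all _ fun q => ?_)
  simp only [ENNReal.toReal_ofReal (hp.nonneg _ _), smul_eq_mul]
  ring

/-- The `n`-th partial moment in the second variable. -/
def partialMoment (p : ℝ → ℝ → ℝ) (n : ℕ) (t : ℝ) : ℝ := ∫ e, e ^ n * p t e

theorem norm_pow_mul_le (hp : IsDominatedDensity p g₀ g₁) (n : ℕ) (t e : ℝ) :
    ‖e ^ n * p t e‖ ≤ |e| ^ n * g₀ e := by
  rw [norm_mul, norm_pow, Real.norm_eq_abs, Real.norm_of_nonneg (hp.nonneg t e)]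
  exact mul_le_mul_of_nonneg_left (hp.le t e) (by positivity)

theorem integrable_pow_mul (hp : IsDominatedDensity p g₀ g₁) {n : ℕ} (hn : n ≤ 4) (t : ℝ) :
    Integrable fun e => e ^ n * p t e :=
  (hp.integrable_pow₀ n hn).mono'
    ((measurable_id.pow_const n).mul (hp.measurable_right t)).aestronglyMeasurable
    (ae_of_all _ fun e => hp.norm_pow_mul_le n t e)

/-- Dominated convergence. Conditioning on `H` identifies these moments only for almost every `t`;
continuity extends the identities to the single point that matters. -/
theorem continuous_partialMoment (hp : IsDominatedDensity p g₀ g₁) {n : ℕ} (hn : n ≤ 4) :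
    Continuous (partialMoment p n) :=
  continuous_of_dominated
    (fun t => (hp.integrable_pow_mul hn t).aestronglyMeasurable)
    (fun t => ae_of_all _ fun e => hp.norm_pow_mul_le n t e) (hp.integrable_pow₀ n hn)
    (ae_of_all _ fun e => continuous_const.mul (hp.differentiable e).continuous)

theorem abs_partialMoment_le (hp : IsDominatedDensity p g₀ g₁) {n : ℕ} (hn : n ≤ 4) (t : ℝ) :
    |partialMoment p n t| ≤ ∫ e, |e| ^ n * g₀ e :=
  norm_integral_le_of_norm_le (hp.integrable_pow₀ n hn)
    (ae_of_all _ fun e => hp.norm_pow_mul_le n t e)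

/-- Fubini. The set must have finite volume because the bound `g₀` does not decay in `t`. -/
theorem setIntegral_partialMoment (hp : IsDominatedDensity p g₀ g₁) {n : ℕ} (hn : n ≤ 4)
    {B : Set ℝ} (hB : MeasurableSet B) (hB' : volume B < ⊤) :
    ∫ t in B, partialMoment p n t = ∫ q, B.indicator 1 q.1 * q.2 ^ n ∂(law p) := by
  have hind : Integrable (B.indicator (1 : ℝ → ℝ)) :=
    (integrable_indicator_iff hB).2 (integrableOn_const (μ := volume) (C := (1 : ℝ)) hB'.ne)
  have hdom := hind.mul_prod (hp.integrable_pow₀ n hn)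
  have hm : Measurable fun q : ℝ × ℝ => B.indicator (1 : ℝ → ℝ) q.1 * q.2 ^ n * p q.1 q.2 :=
    ((((measurable_one.indicator hB).comp measurable_fst).mul
      (measurable_snd.pow_const n)).mul hp.measurable)
  have hint : Integrable (fun q : ℝ × ℝ => B.indicator (1 : ℝ → ℝ) q.1 * q.2 ^ n * p q.1 q.2)
      (volume.prod volume) := by
    refine hdom.mono' hm.aestronglyMeasurable (ae_of_all _ fun q => ?_)
    rw [mul_assoc, norm_mul]
    have h0 : 0 ≤ B.indicator (1 : ℝ → ℝ) q.1 := Set.indicator_nonneg (fun _ _ => zero_le_one) _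
    rw [Real.norm_of_nonneg h0]
    exact mul_le_mul_of_nonneg_left (hp.norm_pow_mul_le n q.1 q.2) h0
  rw [hp.integral_law, Measure.volume_eq_prod, integral_prod _ hint, ← integral_indicator hB]
  refine integral_congr_ae (ae_of_all _ fun t => ?_)
  simp only [mul_assoc]
  rw [integral_const_mul]
  by_cases ht : t ∈ B <;> simp [ht, partialMoment]

/-- First-order expansion of the expectation of a kernel concentrated near the line `s = t`. -/
theorem abs_integral_sub_le (hp : IsDominatedDensity p g₀ g₁) {K : ℝ × ℝ → ℝ}
    (hK : Measurable K) {δ t c : ℝ} (hδ : 0 ≤ δ) (hc : 0 ≤ c) {n : ℕ} (hn : n + 2 ≤ 4)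
    (hle : ∀ q, |K q| ≤ c * |q.2| ^ n) (hsupp : ∀ q : ℝ × ℝ, |δ * q.2| < |q.1 - t| → K q = 0) :
    |∫ q, K q ∂(law p) - ∫ e, (∫ s, K (s, e)) * p t e| ≤
      2 * c * δ ^ 2 * ∫ e, |e| ^ (n + 2) * g₁ e := by
  -- For fixed `e` the kernel vanishes outside this interval of length `2δ|e|`. This length supplies
  -- the extra factor `|e|` in the integrability bounds below.
  set I : ℝ → Set ℝ := fun e => Set.Icc (t - δ * |e|) (t + δ * |e|) with hI
  have hvol : ∀ e, volume.real (I e) = 2 * δ * |e| := by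
    intro e
    have : 0 ≤ δ * |e| := by positivity
    rw [hI, Real.volume_real_Icc_of_le (by linarith)]; ring
  have hnot : ∀ s e, s ∉ I e → K (s, e) = 0 := by
    intro s e hs
    refine hsupp _ ?_
    simp only [hI, Set.mem_Icc, not_and_or, not_le] at hs
    rw [abs_mul, abs_of_nonneg hδ]
    rcases hs with h | h
    · exact lt_of_lt_of_le (by linarith) (neg_le_abs _)
    · exact lt_of_lt_of_le (by linarith) (le_abs_self _)
  have hindint : ∀ (e a : ℝ), Integrable ((I e).indicator fun _ => a) := fun e a =>
    (integrable_indicator_iff measurableSet_Icc).2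
      (integrableOn_const (μ := volume) (C := a) measure_Icc_lt_top.ne)
  have hindval : ∀ (e a : ℝ), ∫ s, (I e).indicator (fun _ => a) s = 2 * δ * |e| * a := by
    intro e a
    rw [integral_indicator measurableSet_Icc, setIntegral_const, hvol, smul_eq_mul]
  have hKle : ∀ s e, ‖K (s, e)‖ ≤ (I e).indicator (fun _ => c * |e| ^ n) s := by
    intro s e
    by_cases hs : s ∈ I e
    · rw [Set.indicator_of_mem hs]; exact hle (s, e)
    · rw [Set.indicator_of_notMem hs, hnot s e hs, norm_zero]
  have hKm : ∀ e, Measurable fun s => K (s, e) := fun e =>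
    hK.comp (measurable_id.prodMk measurable_const)
  have hKint : ∀ e, Integrable fun s => K (s, e) := fun e =>
    (hindint e _).mono' (hKm e).aestronglyMeasurable (ae_of_all _ fun s => hKle s e)
  have hpm : ∀ e, Measurable fun s => p s e := fun e =>
    hp.measurable.comp (measurable_id.prodMk measurable_const)
  have hKple : ∀ s e, ‖K (s, e) * p s e‖ ≤ (I e).indicator (fun _ => c * |e| ^ n * g₀ e) s := by
    intro s e
    rw [norm_mul, Real.norm_of_nonneg (hp.nonneg s e)]
    have h1 := mul_le_mul (hKle s e) (hp.le s e) (hp.nonneg s e)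
      (Set.indicator_nonneg (fun _ _ => by positivity) _)
    refine h1.trans (le_of_eq ?_)
    by_cases hs : s ∈ I e <;> simp [hs]
  have hKpint : ∀ e, Integrable fun s => K (s, e) * p s e := fun e =>
    (hindint e _).mono' ((hKm e).mul (hpm e)).aestronglyMeasurable
      (ae_of_all _ fun s => hKple s e)
  have hKpm : Measurable fun q : ℝ × ℝ => K q * p q.1 q.2 := hK.mul hp.measurable
  have hprod : Integrable (fun q : ℝ × ℝ => K q * p q.1 q.2) (volume.prod volume) := by
    rw [integrable_prod_iff' hKpm.aestronglyMeasurable]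
    refine ⟨ae_of_all _ fun e => hKpint e, ?_⟩
    refine ((hp.integrable_pow₀ (n + 1) (by omega)).const_mul (2 * δ * c)).mono'
      hKpm.stronglyMeasurable.norm.integral_prod_left'.aestronglyMeasurable (ae_of_all _ fun e => ?_)
    rw [Real.norm_of_nonneg (integral_nonneg fun _ => norm_nonneg _)]
    refine (integral_mono (hKpint e).norm (hindint e _) fun s => hKple s e).trans (le_of_eq ?_)
    rw [hindval]; ring
  have hinner : Integrable fun e => ∫ s, K (s, e) * p s e := hprod.integral_prod_right
  have hkint : Integrable fun e => (∫ s, K (s, e)) * p t e := by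
    refine ((hp.integrable_pow₀ (n + 1) (by omega)).const_mul (2 * δ * c)).mono'
      ((hK.stronglyMeasurable.integral_prod_left'.measurable.mul
        (hp.measurable_right t)).aestronglyMeasurable) (ae_of_all _ fun e => ?_)
    rw [norm_mul, Real.norm_of_nonneg (hp.nonneg t e)]
    have h1 := norm_integral_le_of_norm_le (hindint e _) (ae_of_all _ fun s => hKle s e)
    rw [hindval] at h1
    have h2 := mul_le_mul h1 (hp.le t e) (hp.nonneg t e) (by positivity)
    refine h2.trans (le_of_eq ?_)
    ring
  rw [hp.integral_law, Measure.volume_eq_prod, integral_prod_symm _ hprod,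
    ← integral_sub hinner hkint, ← integral_const_mul, ← Real.norm_eq_abs]
  refine norm_integral_le_of_norm_le
    ((hp.integrable_pow₁ (n + 2) hn).const_mul (2 * c * δ ^ 2)) (ae_of_all _ fun e => ?_)
  rw [← integral_mul_const, ← integral_sub (hKpint e) ((hKint e).mul_const _)]
  -- The Lipschitz bound on `p` gives one factor `δ|e|` and the length of `I e` another: hence `δ ^
  -- 2` and the moment of order `n + 2`.
  have hdiff : ∀ s, ‖K (s, e) * p s e - K (s, e) * p t e‖ ≤
      (I e).indicator (fun _ => c * |e| ^ n * (g₁ e * (δ * |e|))) s := by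
    intro s
    by_cases hs : s ∈ I e
    · rw [Set.indicator_of_mem hs, ← mul_sub, norm_mul]
      have h1 : |s - t| ≤ δ * |e| := by
        rw [abs_le]; constructor <;> linarith [hs.1, hs.2]
      exact mul_le_mul (hle (s, e)) ((hp.abs_sub_le s t e).trans
        (mul_le_mul_of_nonneg_left h1 (hp.deriv_bound_nonneg e))) (norm_nonneg _) (by positivity)
    · rw [Set.indicator_of_notMem hs, hnot s e hs]; simp
  refine (norm_integral_le_of_norm_le (hindint e _) (ae_of_all _ hdiff)).trans (le_of_eq ?_)
  rw [hindval]; ring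

/-- The main term of the expansion is `-δ` times the first partial moment, so only the error of
order `δ ^ 2` remains. -/
theorem abs_integral_indicatorShift_le (hp : IsDominatedDensity p g₀ g₁) {δ t : ℝ} (hδ : 0 ≤ δ)
    (hzero : partialMoment p 1 t = 0) :
    |∫ q, indicatorShift δ t q ∂(law p)| ≤ 2 * δ ^ 2 * ∫ e, |e| ^ 2 * g₁ e := by
  have := hp.abs_integral_sub_le (measurable_indicatorShift δ t) hδ zero_le_one (n := 0)
    (by norm_num) (by simpa using abs_indicatorShift_le δ t) fun q => indicatorShift_eq_zero
  have h0 : ∫ e, (∫ s, indicatorShift δ t (s, e)) * p t e = 0 := by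
    simp_rw [integral_indicatorShift]
    have : ∀ e, -(δ * e) * p t e = -δ * (e ^ 1 * p t e) := fun e => by ring
    simp_rw [this]
    rw [integral_const_mul]
    change -δ * partialMoment p 1 t = 0
    rw [hzero, mul_zero]
  rw [h0, sub_zero] at this
  simpa using this

/-- Here the kernel itself is at most `δ|e|`: the expansion is used with `c = δ` and `n = 1`, which
improves the error to `δ ^ 3`. -/
theorem abs_integral_posPartShift_sub_le (hp : IsDominatedDensity p g₀ g₁) {δ t : ℝ}
    (hδ : 0 ≤ δ) :
    |∫ q, posPartShift δ t q ∂(law p) - δ ^ 2 / 2 * partialMoment p 2 t| ≤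
      2 * δ ^ 3 * ∫ e, |e| ^ 3 * g₁ e := by
  have := hp.abs_integral_sub_le (measurable_posPartShift δ t) hδ hδ (n := 1)
    (by norm_num)
    (fun q => by simpa [abs_mul, abs_of_nonneg hδ] using abs_posPartShift_le δ t q)
    fun q => posPartShift_eq_zero
  have h0 : ∫ e, (∫ s, posPartShift δ t (s, e)) * p t e = δ ^ 2 / 2 * partialMoment p 2 t := by
    simp_rw [integral_posPartShift]
    have : ∀ e, (δ * e) ^ 2 / 2 * p t e = δ ^ 2 / 2 * (e ^ 2 * p t e) := fun e => by ring
    simp_rw [this]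
    rw [integral_const_mul]
    rfl
  rw [h0] at this
  refine this.trans (le_of_eq ?_)
  ring

end IsDominatedDensity

/-! ### Conditional moments of the normalized noise -/

section Noise

variable {P : Measure Θ} [IsProbabilityMeasure P] {κ : Kernel Θ Ξ} [IsMarkovKernel κ]
  {h : Θ → Ξ → ℝ}

instance : IsProbabilityMeasure (scenarioLaw P κ) := by
  unfold scenarioLaw; infer_instance

theorem measurable_meanResponse (hh : Measurable (Function.uncurry h)) :
    Measurable (meanResponse κ h) :=
  (hh.stronglyMeasurable.integral_kernel_prod_right').measurable

theorem measurable_sampleMean (hh : Measurable (Function.uncurry h)) (M : ℕ) :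
    Measurable fun z : Θ × (ℕ → Ξ) => sampleMean h M z.1 z.2 :=
  (Finset.measurable_fun_sum _ fun j _ =>
    hh.comp (measurable_fst.prodMk ((measurable_pi_apply j).comp measurable_snd))).const_mul _

theorem measurable_normalizedNoise (hh : Measurable (Function.uncurry h)) (M : ℕ) :
    Measurable fun z : Θ × (ℕ → Ξ) => normalizedNoise κ h M z.1 z.2 :=
  ((Finset.measurable_fun_sum _ fun j _ =>
    (hh.comp (measurable_fst.prodMk ((measurable_pi_apply j).comp measurable_snd))).sub
      ((measurable_meanResponse hh).comp measurable_fst)).const_mul _).const_mul _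

theorem sampleMean_eq {M : ℕ} (hM : 1 ≤ M) (θ : Θ) (ξ : ℕ → Ξ) :
    sampleMean h M θ ξ =
      meanResponse κ h θ + (Real.sqrt M)⁻¹ * normalizedNoise κ h M θ ξ := by
  have hM' : (0 : ℝ) < M := by exact_mod_cast hM
  have hs : Real.sqrt M ≠ 0 := (Real.sqrt_pos.2 hM').ne'
  rw [normalizedNoise, inv_mul_cancel_left₀ hs, Finset.sum_sub_distrib, sampleMean]
  simp only [Finset.sum_const, Finset.card_range, nsmul_eq_mul]
  field_simp
  ring

/-- Given `θ`, the noise is a normalized sum over the coordinate process, so the moment formulas for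
i.i.d. samples apply to the inner level as well. -/
theorem normalizedNoise_eq {M : ℕ} (hM : 1 ≤ M) (θ : Θ) :
    normalizedNoise κ h M θ = normalizedSum (κ θ) (fun j (ξ : ℕ → Ξ) => ξ j) M (h θ) := by
  have hM' : (0 : ℝ) < M := by exact_mod_cast hM
  have hs : Real.sqrt M ≠ 0 := (Real.sqrt_pos.2 hM').ne'
  ext ξ
  simp only [normalizedNoise, normalizedSum, Finset.sum_sub_distrib, Finset.sum_const,
    Finset.card_range, nsmul_eq_mul, meanResponse, ← mul_assoc]
  congr 1
  field_simp
  rw [Real.sq_sqrt hM'.le]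

/-- The conditional variance of the response. -/
def responseVariance (κ : Kernel Θ Ξ) (h : Θ → Ξ → ℝ) (θ : Θ) : ℝ := variance (h θ) (κ θ)

theorem measurable_section (hh : Measurable (Function.uncurry h)) (θ : Θ) : Measurable (h θ) :=
  hh.comp (measurable_const.prodMk measurable_id)

theorem measurable_coord (j : ℕ) : Measurable fun ξ : ℕ → Ξ => ξ j := measurable_pi_apply j

theorem iIndepFun_coord (θ : Θ) : iIndepFun (fun j (ξ : ℕ → Ξ) => ξ j) (iidKernel κ θ) :=
  iIndepFun_infinitePi (P := fun _ : ℕ => κ θ) (X := fun _ x => x) fun _ => by fun_prop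

theorem hasLaw_coord (θ : Θ) (j : ℕ) : HasLaw (fun ξ : ℕ → Ξ => ξ j) (κ θ) (iidKernel κ θ) :=
  (measurePreserving_eval_infinitePi (fun _ : ℕ => κ θ) j).hasLaw

theorem integral_normalizedNoise {M : ℕ} (hM : 1 ≤ M)
    {θ : Θ} (hθ : MemLp (h θ) 2 (κ θ)) : ∫ ξ, normalizedNoise κ h M θ ξ ∂(iidKernel κ θ) = 0 := by
  rw [normalizedNoise_eq hM]
  exact integral_normalizedSum measurable_coord (hasLaw_coord θ) hθ M

/-- The factor `√M` makes the conditional variance independent of `M`; this is why the leading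
coefficient of the bias is the same for all `M`. -/
theorem integral_normalizedNoise_sq (hh : Measurable (Function.uncurry h)) {M : ℕ} (hM : 1 ≤ M)
    {θ : Θ} (hθ : MemLp (h θ) 2 (κ θ)) :
    ∫ ξ, normalizedNoise κ h M θ ξ ^ 2 ∂(iidKernel κ θ) = responseVariance κ h θ := by
  rw [normalizedNoise_eq hM]
  exact integral_normalizedSum_sq measurable_coord (iIndepFun_coord θ) (hasLaw_coord θ)
    (measurable_section hh θ) hθ hM

theorem memLp_normalizedNoise_fiber {M : ℕ} (hM : 1 ≤ M)
    {θ : Θ} (hθ : MemLp (h θ) 2 (κ θ)) : MemLp (normalizedNoise κ h M θ) 2 (iidKernel κ θ) := by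
  rw [normalizedNoise_eq hM]
  exact memLp_normalizedSum measurable_coord (hasLaw_coord θ) hθ M

theorem memLp_two_of_lintegral_sq {S : Type*} [MeasurableSpace S] {ρ : Measure S} {u : S → ℝ}
    (hu : Measurable u) (h2 : ∫⁻ x, ENNReal.ofReal (u x ^ 2) ∂ρ < ⊤) : MemLp u 2 ρ := by
  rw [memLp_two_iff_integrable_sq hu.aestronglyMeasurable]
  refine ⟨(hu.pow_const 2).aestronglyMeasurable, ?_⟩
  rwa [hasFiniteIntegral_iff_ofReal (ae_of_all _ fun x => sq_nonneg _)]

namespace StrongAssumption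

theorem ae_memLp (hs : StrongAssumption P κ h) (hh : Measurable (Function.uncurry h)) :
    ∀ᵐ θ ∂P, MemLp (h θ) 2 (κ θ) :=
  hs.conditional_second_moment.mono fun θ hθ =>
    memLp_two_of_lintegral_sq (measurable_section hh θ) hθ

theorem memLp_meanResponse (hs : StrongAssumption P κ h) (hh : Measurable (Function.uncurry h)) :
    MemLp (meanResponse κ h) 2 P := by
  refine memLp_two_of_lintegral_sq (measurable_meanResponse hh)
    (lt_of_le_of_lt (lintegral_mono_ae ?_) hs.second_moment)
  filter_upwards [hs.ae_memLp hh] with θ hθ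
  rw [← ofReal_integral_eq_lintegral_ofReal hθ.integrable_sq (ae_of_all _ fun _ => sq_nonneg _)]
  refine ENNReal.ofReal_le_ofReal ?_
  have := variance_eq_sub hθ
  have h0 := variance_nonneg (h θ) (κ θ)
  simp only [Pi.pow_apply] at this
  unfold meanResponse
  linarith

theorem memLp_fst (hs : StrongAssumption P κ h) (hh : Measurable (Function.uncurry h)) :
    MemLp (fun z => meanResponse κ h z.1) 2 (scenarioLaw P κ) :=
  (hs.memLp_meanResponse hh).comp_measurePreserving
    ⟨measurable_fst, Measure.fst_compProd P (iidKernel κ)⟩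

theorem memLp_normalizedNoise (hs : StrongAssumption P κ h)
    (hh : Measurable (Function.uncurry h)) {M : ℕ} (hM : 1 ≤ M) :
    MemLp (fun z => normalizedNoise κ h M z.1 z.2) 2 (scenarioLaw P κ) := by
  have hm := measurable_normalizedNoise (κ := κ) hh M
  refine memLp_two_of_lintegral_sq hm (lt_of_le_of_lt ?_ hs.second_moment)
  rw [scenarioLaw, Measure.lintegral_compProd (hm.pow_const 2).ennreal_ofReal]
  refine lintegral_mono_ae ?_
  filter_upwards [hs.ae_memLp hh] with θ hθ
  rw [← ofReal_integral_eq_lintegral_ofReal (memLp_normalizedNoise_fiber hM hθ).integrable_sq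
      (ae_of_all _ fun _ => sq_nonneg _),
    ← ofReal_integral_eq_lintegral_ofReal hθ.integrable_sq (ae_of_all _ fun _ => sq_nonneg _)]
  refine ENNReal.ofReal_le_ofReal ?_
  rw [integral_normalizedNoise_sq hh hM hθ]
  exact variance_le_expectation_sq (measurable_section hh θ).aestronglyMeasurable

theorem integrable_indicator_mul {B : Set ℝ} (hB : MeasurableSet B)
    (hh : Measurable (Function.uncurry h)) {u : Θ × (ℕ → Ξ) → ℝ}
    (hu : Integrable u (scenarioLaw P κ)) :
    Integrable (fun z => B.indicator 1 (meanResponse κ h z.1) * u z) (scenarioLaw P κ) := by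
  have hm : Measurable fun z : Θ × (ℕ → Ξ) => B.indicator (1 : ℝ → ℝ) (meanResponse κ h z.1) :=
    (measurable_one.indicator hB).comp ((measurable_meanResponse hh).comp measurable_fst)
  refine hu.bdd_mul (c := 1) hm.aestronglyMeasurable (ae_of_all _ fun z => ?_)
  by_cases hz : meanResponse κ h z.1 ∈ B <;> simp [hz]

/-- Conditionally on `θ` the indicator is constant and the noise is centered. -/
theorem integral_indicator_mul_normalizedNoise (hs : StrongAssumption P κ h)
    (hh : Measurable (Function.uncurry h)) {M : ℕ} (hM : 1 ≤ M) {B : Set ℝ}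
    (hB : MeasurableSet B) :
    ∫ z, B.indicator 1 (meanResponse κ h z.1) * normalizedNoise κ h M z.1 z.2
      ∂(scenarioLaw P κ) = 0 := by
  have hi := integrable_indicator_mul hB hh ((hs.memLp_normalizedNoise hh hM).integrable one_le_two)
  rw [scenarioLaw] at hi ⊢
  rw [Measure.integral_compProd hi]
  refine integral_eq_zero_of_ae ?_
  filter_upwards [hs.ae_memLp hh] with θ hθ
  rw [integral_const_mul, integral_normalizedNoise hM hθ, mul_zero]
  rfl

theorem integral_indicator_mul_normalizedNoise_sq (hs : StrongAssumption P κ h)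
    (hh : Measurable (Function.uncurry h)) {M : ℕ} (hM : 1 ≤ M) {B : Set ℝ}
    (hB : MeasurableSet B) :
    ∫ z, B.indicator 1 (meanResponse κ h z.1) * normalizedNoise κ h M z.1 z.2 ^ 2
      ∂(scenarioLaw P κ) =
      ∫ θ, B.indicator 1 (meanResponse κ h θ) * responseVariance κ h θ ∂P := by
  have hi := integrable_indicator_mul hB hh (hs.memLp_normalizedNoise hh hM).integrable_sq
  rw [scenarioLaw] at hi ⊢
  rw [Measure.integral_compProd hi]
  refine integral_congr_ae ?_
  filter_upwards [hs.ae_memLp hh] with θ hθ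
  rw [integral_const_mul, integral_normalizedNoise_sq hh hM hθ]

theorem integral_normalizedNoise_sq (hs : StrongAssumption P κ h)
    (hh : Measurable (Function.uncurry h)) {M : ℕ} (hM : 1 ≤ M) :
    ∫ z, normalizedNoise κ h M z.1 z.2 ^ 2 ∂(scenarioLaw P κ) =
      ∫ θ, responseVariance κ h θ ∂P := by
  simpa using hs.integral_indicator_mul_normalizedNoise_sq hh hM MeasurableSet.univ

end StrongAssumption

end Noise

/-! ### The value-at-risk of a variable with a density -/

section Density

variable {P : Measure Θ} [IsProbabilityMeasure P] {H : Θ → ℝ} {f : ℝ → ℝ}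

theorem IsDensityOf.integrable (hf : IsDensityOf f P H) (hH : Measurable H) : Integrable f := by
  refine ⟨hf.measurable.aestronglyMeasurable, ?_⟩
  rw [hasFiniteIntegral_iff_ofReal (ae_of_all _ hf.nonneg)]
  have := congrArg (fun ν : Measure ℝ => ν Set.univ) hf.map_eq
  simp only [Measure.map_apply hH MeasurableSet.univ, withDensity_apply _ MeasurableSet.univ,
    Measure.restrict_univ, Set.preimage_univ, measure_univ] at this
  rw [← this]; exact ENNReal.one_lt_top

theorem IsDensityOf.measureReal_mem (hf : IsDensityOf f P H) (hH : Measurable H) {B : Set ℝ}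
    (hB : MeasurableSet B) : P.real {x | H x ∈ B} = ∫ t in B, f t := by
  have h1 : P {x | H x ∈ B} = ∫⁻ t in B, ENNReal.ofReal (f t) := by
    have h0 : P.map H B = P {x | H x ∈ B} := Measure.map_apply hH hB
    rw [← h0, hf.map_eq, withDensity_apply _ hB]
  rw [measureReal_def, h1, integral_eq_lintegral_of_nonneg_ae (ae_of_all _ hf.nonneg)
    hf.measurable.aestronglyMeasurable]

theorem IsDensityOf.measureReal_le_sub (hf : IsDensityOf f P H) (hH : Measurable H) (s t : ℝ) :
    P.real {x | H x ≤ t} = P.real {x | H x ≤ s} + ∫ u in s..t, f u := by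
  have h1 := hf.measureReal_mem hH (measurableSet_Iic (a := t))
  have h2 := hf.measureReal_mem hH (measurableSet_Iic (a := s))
  simp only [Set.mem_Iic] at h1 h2
  rw [h1, h2, ← intervalIntegral.integral_Iic_sub_Iic (hf.integrable hH).integrableOn
    (hf.integrable hH).integrableOn]
  ring

theorem IsDensityOf.continuous_cdf (hf : IsDensityOf f P H) (hH : Measurable H) :
    Continuous fun t => P.real {x | H x ≤ t} := by
  rw [funext (hf.measureReal_le_sub hH 0)]
  exact continuous_const.add (intervalIntegral.continuous_primitive
    (fun a b => (hf.integrable hH).intervalIntegrable) 0)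

theorem IsDensityOf.hasDerivAt_cdf (hf : IsDensityOf f P H) (hH : Measurable H) {v : ℝ}
    (hc : ContinuousAt f v) : HasDerivAt (fun t => P.real {x | H x ≤ t}) (f v) v := by
  rw [funext (hf.measureReal_le_sub hH v)]
  exact (intervalIntegral.integral_hasDerivAt_right (hf.integrable hH).intervalIntegrable
    hf.measurable.stronglyMeasurable.stronglyMeasurableAtFilter hc).const_add _

/-- The distribution function is continuous. The superlevel set is thus closed and contains its
infimum, giving `≥ α`; on the left of the infimum the function is below `α`, giving `≤ α` in the
limit. -/
theorem IsDensityOf.cdf_VaR (hf : IsDensityOf f P H) (hH : Measurable H) {α : ℝ} (hα0 : 0 < α)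
    (hα1 : α < 1) : P.real {x | H x ≤ VaR P H α} = α := by
  have : IsProbabilityMeasure (P.map H) := Measure.isProbabilityMeasure_map hH.aemeasurable
  have hcdf : ∀ t, cdf (P.map H) t = P.real {x | H x ≤ t} := fun t => by
    rw [cdf_eq_real, map_measureReal_apply hH measurableSet_Iic]; rfl
  have hbot := (tendsto_cdf_atBot (P.map H)).congr hcdf
  have htop := (tendsto_cdf_atTop (P.map H)).congr hcdf
  have hmono : Monotone fun t => P.real {x | H x ≤ t} := fun s t hst =>
    measureReal_mono fun x hx => le_trans hx hst
  have hcont := hf.continuous_cdf hH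
  set S := {t : ℝ | α ≤ P.real {x | H x ≤ t}} with hS
  have hne : S.Nonempty := by
    obtain ⟨t, ht⟩ := (htop.eventually_const_lt hα1).exists
    exact ⟨t, ht.le⟩
  have hbdd : BddBelow S := by
    obtain ⟨t, ht⟩ := (hbot.eventually_lt_const hα0).exists
    refine ⟨t, fun s hs => ?_⟩
    by_contra hlt
    exact absurd (le_trans hs (hmono (not_le.1 hlt).le)) (not_le.2 ht)
  have hclosed : IsClosed S := isClosed_le continuous_const hcont
  refine le_antisymm ?_ (hclosed.csInf_mem hne hbdd)
  refine le_of_tendsto (hcont.continuousWithinAt (s := Set.Iio (VaR P H α))) ?_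
  filter_upwards [self_mem_nhdsWithin] with t ht
  exact (not_le.1 (notMem_of_lt_csInf (s := S) ht hbdd)).le

end Density

/-! ### The bias of the nested simulation -/

section Bias

variable {P : Measure Θ} [IsProbabilityMeasure P] {κ : Kernel Θ Ξ} [IsMarkovKernel κ]
  {h : Θ → Ξ → ℝ}

theorem StrongAssumption.exists_isDominatedDensity (hs : StrongAssumption P κ h) :
    ∃ (p : ℕ → ℝ → ℝ → ℝ) (g₀ g₁ : ℕ → ℝ → ℝ) (C : ℝ), 0 ≤ C ∧ ∀ M, 1 ≤ M →
      IsDominatedDensity (p M) (g₀ M) (g₁ M) ∧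
      (scenarioLaw P κ).map (fun z => (meanResponse κ h z.1, normalizedNoise κ h M z.1 z.2)) =
        IsDominatedDensity.law (p M) ∧
      ∀ n ≤ 4, ∫ e, |e| ^ n * g₁ M e ≤ C := by
  obtain ⟨p, g, hpm, hp0, hlaw, hdiff, hg, hle, hmom⟩ := hs.joint_density
  have hmom' : ∀ (i : Fin 3) (n : ℕ), ∃ C : ℝ, n ≤ 4 → 0 ≤ C ∧ ∀ M, 1 ≤ M →
      Integrable (fun e => |e| ^ n * g i M e) ∧ ∫ e, |e| ^ n * g i M e ≤ C := by
    intro i n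
    by_cases hn : n ≤ 4
    swap
    · exact ⟨0, fun h => absurd h hn⟩
    obtain ⟨C, hC⟩ := hmom i n (by positivity) (by exact_mod_cast hn)
    -- The given constant may be negative, in which case `ENNReal.ofReal` truncates it to zero.
    refine ⟨max C 0, fun _ => ⟨le_max_right _ _, fun M hM => ?_⟩⟩
    have hCM := hC M hM
    simp only [Real.rpow_natCast] at hCM
    have hnn : ∀ e, 0 ≤ |e| ^ n * g i M e := fun e =>
      mul_nonneg (by positivity) ((hg i M hM).2 e)
    have hmeas : Measurable fun e => |e| ^ n * g i M e :=
      (measurable_id.abs.pow_const n).mul (hg i M hM).1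
    refine ⟨⟨hmeas.aestronglyMeasurable, ?_⟩, ?_⟩
    · rw [hasFiniteIntegral_iff_ofReal (ae_of_all _ hnn)]
      exact hCM.trans_lt ENNReal.ofReal_lt_top
    · rw [integral_eq_lintegral_of_nonneg_ae (ae_of_all _ hnn) hmeas.aestronglyMeasurable]
      refine ENNReal.toReal_le_of_le_ofReal (le_max_right _ _) (hCM.trans ?_)
      exact ENNReal.ofReal_le_ofReal (le_max_left _ _)
  choose C hC using hmom'
  -- The sum of the five nonnegative constants for `n ≤ 4` dominates each of them.
  refine ⟨p, g 0, g 1, ∑ n ∈ Finset.range 5, C 1 n, ?_, fun M hM => ⟨⟨hpm M hM, hp0 M hM,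
    fun e t => (hdiff M hM t e).1, fun t e => (hle M hM t e).1, fun t e => (hle M hM t e).2.1,
    fun n hn => ((hC 0 n hn).2 M hM).1, fun n hn => ((hC 1 n hn).2 M hM).1⟩, hlaw M hM,
    fun n hn => ?_⟩⟩
  · exact Finset.sum_nonneg fun n hn => (hC 1 n (by have := Finset.mem_range.1 hn; omega)).1
  · refine ((hC 1 n hn).2 M hM).2.trans ?_
    exact Finset.single_le_sum (f := fun n => C 1 n)
      (fun m hm => (hC 1 m (by have := Finset.mem_range.1 hm; omega)).1)
      (Finset.mem_range.2 (by omega))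

theorem IsDominatedDensity.integrableOn_partialMoment {p : ℝ → ℝ → ℝ} {g₀ g₁ : ℝ → ℝ}
    (hp : IsDominatedDensity p g₀ g₁) {n : ℕ} (hn : n ≤ 4) {B : Set ℝ} (hB : volume B < ⊤) :
    IntegrableOn (partialMoment p n) B :=
  Measure.integrableOn_of_bounded hB.ne
    (hp.continuous_partialMoment hn).aestronglyMeasurable
    (ae_of_all _ fun t => hp.abs_partialMoment_le hn t)

theorem integral_law_eq (hh : Measurable (Function.uncurry h)) {M : ℕ} {p : ℝ → ℝ → ℝ}
    (hlaw : (scenarioLaw P κ).map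
      (fun z => (meanResponse κ h z.1, normalizedNoise κ h M z.1 z.2)) =
        IsDominatedDensity.law p) {K : ℝ × ℝ → ℝ} (hK : Measurable K) :
    ∫ q, K q ∂(IsDominatedDensity.law p) =
      ∫ z, K (meanResponse κ h z.1, normalizedNoise κ h M z.1 z.2) ∂(scenarioLaw P κ) := by
  rw [← hlaw, integral_map]
  · exact (((measurable_meanResponse hh).comp measurable_fst).prodMk
      (measurable_normalizedNoise hh M)).aemeasurable
  · exact hK.aestronglyMeasurable

theorem setIntegral_partialMoment_eq (hh : Measurable (Function.uncurry h)) {M : ℕ}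
    {p : ℝ → ℝ → ℝ} {g₀ g₁ : ℝ → ℝ} (hp : IsDominatedDensity p g₀ g₁)
    (hlaw : (scenarioLaw P κ).map
      (fun z => (meanResponse κ h z.1, normalizedNoise κ h M z.1 z.2)) =
        IsDominatedDensity.law p) {n : ℕ} (hn : n ≤ 4) {B : Set ℝ} (hB : MeasurableSet B)
    (hB' : volume B < ⊤) :
    ∫ t in B, IsDominatedDensity.partialMoment p n t =
      ∫ z, B.indicator 1 (meanResponse κ h z.1) * normalizedNoise κ h M z.1 z.2 ^ n
        ∂(scenarioLaw P κ) := by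
  rw [hp.setIntegral_partialMoment hn hB hB', integral_law_eq hh hlaw]
  exact ((measurable_one.indicator hB).comp measurable_fst).mul (measurable_snd.pow_const n)

/-- Its integral over any `B` of finite volume is the expectation of the noise on `H ∈ B`, which is
zero. A continuous function vanishing almost everywhere is zero. -/
theorem partialMoment_one_eq_zero (hs : StrongAssumption P κ h)
    (hh : Measurable (Function.uncurry h)) {M : ℕ} (hM : 1 ≤ M)
    {p : ℝ → ℝ → ℝ} {g₀ g₁ : ℝ → ℝ} (hp : IsDominatedDensity p g₀ g₁)
    (hlaw : (scenarioLaw P κ).map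
      (fun z => (meanResponse κ h z.1, normalizedNoise κ h M z.1 z.2)) =
        IsDominatedDensity.law p) (t : ℝ) : IsDominatedDensity.partialMoment p 1 t = 0 := by
  have hae : IsDominatedDensity.partialMoment p 1 =ᵐ[volume] fun _ => 0 := by
    refine ae_eq_of_forall_setIntegral_eq_of_sigmaFinite
      (fun B _ hB' => hp.integrableOn_partialMoment (by norm_num) hB')
      (fun B _ hB' => integrableOn_zero) fun B hB hB' => ?_
    rw [setIntegral_partialMoment_eq hh hp hlaw (by norm_num) hB hB']
    simpa using hs.integral_indicator_mul_normalizedNoise hh hM hB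
  exact congrFun ((Continuous.ae_eq_iff_eq volume (hp.continuous_partialMoment (by norm_num))
    continuous_const).1 hae) t

/-- Over any `B`, both sides integrate to the mean of the conditional variance on `H ∈ B`, where `M`
does not occur; continuity does the rest. -/
theorem partialMoment_two_eq (hs : StrongAssumption P κ h)
    (hh : Measurable (Function.uncurry h)) {M M' : ℕ} (hM : 1 ≤ M) (hM' : 1 ≤ M')
    {p p' : ℝ → ℝ → ℝ} {g₀ g₁ g₀' g₁' : ℝ → ℝ} (hp : IsDominatedDensity p g₀ g₁)
    (hp' : IsDominatedDensity p' g₀' g₁')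
    (hlaw : (scenarioLaw P κ).map
      (fun z => (meanResponse κ h z.1, normalizedNoise κ h M z.1 z.2)) =
        IsDominatedDensity.law p)
    (hlaw' : (scenarioLaw P κ).map
      (fun z => (meanResponse κ h z.1, normalizedNoise κ h M' z.1 z.2)) =
        IsDominatedDensity.law p') :
    IsDominatedDensity.partialMoment p 2 = IsDominatedDensity.partialMoment p' 2 := by
  refine (Continuous.ae_eq_iff_eq volume (hp.continuous_partialMoment (by norm_num))
    (hp'.continuous_partialMoment (by norm_num))).1 ?_
  refine ae_eq_of_forall_setIntegral_eq_of_sigmaFinite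
    (fun B _ hB' => hp.integrableOn_partialMoment (by norm_num) hB')
    (fun B _ hB' => hp'.integrableOn_partialMoment (by norm_num) hB') fun B hB hB' => ?_
  rw [setIntegral_partialMoment_eq hh hp hlaw (by norm_num) hB hB',
    setIntegral_partialMoment_eq hh hp' hlaw' (by norm_num) hB hB',
    hs.integral_indicator_mul_normalizedNoise_sq hh hM hB,
    hs.integral_indicator_mul_normalizedNoise_sq hh hM' hB]

theorem measureReal_fst {p : Θ → Prop} (hp : MeasurableSet {θ | p θ}) :
    (scenarioLaw P κ).real {z | p z.1} = P.real {θ | p θ} :=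
  (MeasurePreserving.hasLaw ⟨measurable_fst, Measure.fst_compProd P (iidKernel κ)⟩).measureReal_eq
    hp

/-- Both functions are densities of `H`, so they agree on a dense set. Continuity of `f` at `v`
alone allows passage to the limit along that set. -/
theorem partialMoment_zero_eq (hh : Measurable (Function.uncurry h)) {M : ℕ}
    {p : ℝ → ℝ → ℝ} {g₀ g₁ : ℝ → ℝ} (hp : IsDominatedDensity p g₀ g₁)
    (hlaw : (scenarioLaw P κ).map
      (fun z => (meanResponse κ h z.1, normalizedNoise κ h M z.1 z.2)) =
        IsDominatedDensity.law p)
    {f : ℝ → ℝ} (hf : IsDensityOf f P (meanResponse κ h)) {v : ℝ} (hc : ContinuousAt f v) :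
    IsDominatedDensity.partialMoment p 0 v = f v := by
  have hH := measurable_meanResponse (κ := κ) hh
  have hae : f =ᵐ[volume] IsDominatedDensity.partialMoment p 0 := by
    refine ae_eq_of_forall_setIntegral_eq_of_sigmaFinite
      (fun B _ _ => (hf.integrable hH).integrableOn)
      (fun B _ hB' => hp.integrableOn_partialMoment (by norm_num) hB') fun B hB hB' => ?_
    rw [setIntegral_partialMoment_eq hh hp hlaw (by norm_num) hB hB',
      ← hf.measureReal_mem hH hB]
    simp only [pow_zero, mul_one]
    have hB1 : MeasurableSet {θ | meanResponse κ h θ ∈ B} := hH hB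
    have hB2 : MeasurableSet {z : Θ × (ℕ → Ξ) | meanResponse κ h z.1 ∈ B} :=
      hB1.preimage measurable_fst
    rw [← measureReal_fst (κ := κ) hB1, ← integral_indicator_one hB2]
    rfl
  have hdense : Dense {t | f t = IsDominatedDensity.partialMoment p 0 t} :=
    Measure.dense_of_ae hae
  have hne : (𝓝[{t | f t = IsDominatedDensity.partialMoment p 0 t}] v).NeBot :=
    mem_closure_iff_nhdsWithin_neBot.1 (hdense v)
  refine tendsto_nhds_unique (f := f)
    (l := 𝓝[{t | f t = IsDominatedDensity.partialMoment p 0 t}] v) ?_ hc.continuousWithinAt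
  refine ((hp.continuous_partialMoment (n := 0) (by norm_num)).continuousWithinAt.tendsto).congr'
    ?_
  filter_upwards [self_mem_nhdsWithin] with t ht using ht.symm

/-- A zero second moment would force `p v e = 0` for almost every `e`, since `e ^ 2 > 0` off the
origin. -/
theorem IsDominatedDensity.partialMoment_two_pos {p : ℝ → ℝ → ℝ} {g₀ g₁ : ℝ → ℝ}
    (hp : IsDominatedDensity p g₀ g₁) {v : ℝ} (hpos : 0 < partialMoment p 0 v) :
    0 < partialMoment p 2 v := by
  have hnn : ∀ e, 0 ≤ e ^ 2 * p v e := fun e => mul_nonneg (sq_nonneg _) (hp.nonneg v e)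
  refine lt_of_le_of_ne (integral_nonneg hnn) fun h0 => hpos.ne' ?_
  have h1 := (integral_eq_zero_iff_of_nonneg hnn (hp.integrable_pow_mul (by norm_num) v)).1 h0.symm
  refine integral_eq_zero_of_ae ?_
  have h2 : ∀ᵐ e : ℝ, e ≠ 0 := Measure.ae_ne volume 0
  filter_upwards [h1, h2] with e he he0
  have : e ^ 2 * p v e = 0 := he
  simpa [he0] using this

end Bias

/-! ### Rates of the bias due to the inner simulation -/

section BiasBounds

variable {P : Measure Θ} [IsProbabilityMeasure P] {κ : Kernel Θ Ξ} [IsMarkovKernel κ]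
  {h : Θ → Ξ → ℝ}

theorem StrongAssumption.memLp_sampleMean (hs : StrongAssumption P κ h)
    (hh : Measurable (Function.uncurry h)) {M : ℕ} (hM : 1 ≤ M) :
    MemLp (fun z => sampleMean h M z.1 z.2) 2 (scenarioLaw P κ) := by
  simp_rw [sampleMean_eq (κ := κ) hM]
  exact (hs.memLp_fst hh).add ((hs.memLp_normalizedNoise hh hM).const_mul _)

/-- The error of the inner sample mean, as a function of the scenario and its noises. -/
def sampleError (κ : Kernel Θ Ξ) (h : Θ → Ξ → ℝ) (M : ℕ) (z : Θ × (ℕ → Ξ)) : ℝ :=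
  sampleMean h M z.1 z.2 - meanResponse κ h z.1

theorem StrongAssumption.integral_sampleError_sq (hs : StrongAssumption P κ h)
    (hh : Measurable (Function.uncurry h)) {M : ℕ} (hM : 1 ≤ M) :
    ∫ z, sampleError κ h M z ^ 2 ∂(scenarioLaw P κ) = (∫ θ, responseVariance κ h θ ∂P) / M := by
  have hM' : (0 : ℝ) < M := by exact_mod_cast hM
  have : ∀ z : Θ × (ℕ → Ξ), sampleError κ h M z ^ 2 =
      (M : ℝ)⁻¹ * normalizedNoise κ h M z.1 z.2 ^ 2 := by
    intro z
    rw [sampleError, sampleMean_eq (κ := κ) hM, add_sub_cancel_left, mul_pow, inv_pow,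
      Real.sq_sqrt hM'.le]
  simp_rw [this]
  rw [integral_const_mul, hs.integral_normalizedNoise_sq hh hM]
  ring

theorem memLp_posPart {S : Type*} [MeasurableSpace S] {Q : Measure S} [IsFiniteMeasure Q]
    {u : S → ℝ} (hu : MemLp u 2 Q) (v : ℝ) : MemLp (fun z => max (u z - v) 0) 2 Q :=
  (hu.sub (memLp_const v)).pos_part

/-- The bias of the expected excess over `v` caused by the inner simulation. -/
def excessBias (P : Measure Θ) (κ : Kernel Θ Ξ) [IsMarkovKernel κ] (h : Θ → Ξ → ℝ) (M : ℕ)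
    (v : ℝ) : ℝ :=
  ∫ z, max (sampleMean h M z.1 z.2 - v) 0 ∂(scenarioLaw P κ) -
    ∫ z, max (meanResponse κ h z.1 - v) 0 ∂(scenarioLaw P κ)

/-- The linear part `δ E` on `H > v` has expectation zero, so subtracting it is free and leaves the
second-order kernel. -/
theorem StrongAssumption.excessBias_eq (hs : StrongAssumption P κ h)
    (hh : Measurable (Function.uncurry h)) {M : ℕ} (hM : 1 ≤ M) (v : ℝ) :
    excessBias P κ h M v = ∫ z, posPartShift (Real.sqrt M)⁻¹ v
      (meanResponse κ h z.1, normalizedNoise κ h M z.1 z.2) ∂(scenarioLaw P κ) := by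
  have h1 := (memLp_posPart (hs.memLp_sampleMean hh hM) v).integrable one_le_two
  have h2 := (memLp_posPart (hs.memLp_fst hh) v).integrable one_le_two
  have h3 := StrongAssumption.integrable_indicator_mul (B := Set.Ioi v) measurableSet_Ioi hh
    ((hs.memLp_normalizedNoise hh hM).integrable one_le_two)
  have h4 := hs.integral_indicator_mul_normalizedNoise hh hM (B := Set.Ioi v) measurableSet_Ioi
  have h5 := integral_sub (h1.sub h2) (h3.const_mul (Real.sqrt M)⁻¹)
  rw [integral_const_mul, h4, mul_zero, sub_zero] at h5
  rw [excessBias, ← integral_sub h1 h2]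
  refine h5.symm.trans ?_
  refine integral_congr_ae (ae_of_all _ fun z => ?_)
  simp only [posPartShift, Pi.sub_apply, sampleMean_eq (κ := κ) hM]
  ring

theorem StrongAssumption.measureReal_sampleMean_sub (hh : Measurable (Function.uncurry h))
    {M : ℕ} (hM : 1 ≤ M) (t : ℝ) :
    (scenarioLaw P κ).real {z | sampleMean h M z.1 z.2 ≤ t} -
      P.real {θ | meanResponse κ h θ ≤ t} = ∫ z, indicatorShift (Real.sqrt M)⁻¹ t
        (meanResponse κ h z.1, normalizedNoise κ h M z.1 z.2) ∂(scenarioLaw P κ) := by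
  have hH : MeasurableSet {θ | meanResponse κ h θ ≤ t} :=
    measurableSet_le (measurable_meanResponse hh) measurable_const
  have hA : MeasurableSet {z : Θ × (ℕ → Ξ) | sampleMean h M z.1 z.2 ≤ t} :=
    measurableSet_le (measurable_sampleMean hh M) measurable_const
  have hX : MeasurableSet {z : Θ × (ℕ → Ξ) | meanResponse κ h z.1 ≤ t} :=
    hH.preimage measurable_fst
  rw [← measureReal_fst (κ := κ) hH, ← integral_indicator_one hA, ← integral_indicator_one hX,
    ← integral_sub ((integrable_const 1).indicator hA) ((integrable_const 1).indicator hX)]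
  refine integral_congr_ae (ae_of_all _ fun z => ?_)
  simp only [indicatorShift, Set.indicator_apply, sampleMean_eq (κ := κ) hM, Set.mem_ofPred_eq,
    Set.mem_Iic, Pi.one_apply]

/-- The inner simulation changes the distribution function by `O(1 / M)`, and the expected excess
over the value-at-risk by a quantity of exact order `1 / M`. -/
theorem StrongAssumption.exists_bias_bounds (hs : StrongAssumption P κ h)
    (hh : Measurable (Function.uncurry h)) {f : ℝ → ℝ}
    (hf : IsDensityOf f P (meanResponse κ h)) {v : ℝ} (hc : ContinuousAt f v) (hpos : 0 < f v) :
    ∃ C c : ℝ, 0 < c ∧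
      (∀ M : ℕ, 1 ≤ M → ∀ t, |(scenarioLaw P κ).real {z | sampleMean h M z.1 z.2 ≤ t} -
        P.real {θ | meanResponse κ h θ ≤ t}| ≤ C / M) ∧
      (∀ M : ℕ, 1 ≤ M → 0 ≤ excessBias P κ h M v ∧ excessBias P κ h M v ≤ C / M) ∧
      ∀ᶠ M : ℕ in atTop, c / M ≤ excessBias P κ h M v := by
  obtain ⟨p, g₀, g₁, C, hC0, hp⟩ := hs.exists_isDominatedDensity
  set J := IsDominatedDensity.partialMoment (p 1) 2 v with hJ
  have hJM : ∀ M, 1 ≤ M → IsDominatedDensity.partialMoment (p M) 2 v = J := fun M hM => by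
    rw [hJ, partialMoment_two_eq hs hh hM le_rfl (hp M hM).1 (hp 1 le_rfl).1 (hp M hM).2.1
      (hp 1 le_rfl).2.1]
  have hJpos : 0 < J := by
    refine (hp 1 le_rfl).1.partialMoment_two_pos ?_
    rw [partialMoment_zero_eq hh (hp 1 le_rfl).1 (hp 1 le_rfl).2.1 hf hc]
    exact hpos
  -- The expansion of the excess with `δ = M^(-1/2)`: leading term `J / (2M)`, error of order
  -- `M^(-3/2)`.
  have hexp : ∀ M : ℕ, 1 ≤ M →
      |excessBias P κ h M v - J / 2 / M| ≤ 2 * C * (Real.sqrt M)⁻¹ / M := by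
    intro M hM
    have hM' : (0 : ℝ) < M := by exact_mod_cast hM
    obtain ⟨hpM, hlaw, hmom⟩ := hp M hM
    have hb := hpM.abs_integral_posPartShift_sub_le (t := v)
      (inv_nonneg.2 (Real.sqrt_nonneg (M : ℝ)))
    rw [integral_law_eq hh hlaw (measurable_posPartShift _ _), ← hs.excessBias_eq hh hM,
      hJM M hM] at hb
    have e1 : ((Real.sqrt M)⁻¹) ^ 2 = 1 / M := by
      rw [inv_pow, Real.sq_sqrt hM'.le, one_div]
    have e2 : ((Real.sqrt M)⁻¹) ^ 3 = (Real.sqrt M)⁻¹ / M := by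
      rw [pow_succ, e1]; ring
    rw [e1, e2] at hb
    have h5 : 1 / (M : ℝ) / 2 * J = J / 2 / M := by ring
    rw [h5] at hb
    refine hb.trans ?_
    calc 2 * ((Real.sqrt M)⁻¹ / M) * ∫ e, |e| ^ 3 * g₁ M e
        ≤ 2 * ((Real.sqrt M)⁻¹ / M) * C :=
          mul_le_mul_of_nonneg_left (hmom 3 (by norm_num)) (by positivity)
      _ = 2 * C * (Real.sqrt M)⁻¹ / M := by ring
  -- The first constant covers both upper bounds. The second is half the leading coefficient `J /
  -- 2`; the other half absorbs the error for large `M`.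
  refine ⟨J / 2 + 2 * C, J / 4, by positivity, ?_, ?_, ?_⟩
  · intro M hM t
    have hM' : (0 : ℝ) < M := by exact_mod_cast hM
    obtain ⟨hpM, hlaw, hmom⟩ := hp M hM
    rw [measureReal_sampleMean_sub hh hM t,
      ← integral_law_eq hh hlaw (measurable_indicatorShift _ _)]
    refine (hpM.abs_integral_indicatorShift_le (inv_nonneg.2 (Real.sqrt_nonneg _))
      (partialMoment_one_eq_zero hs hh hM hpM hlaw t)).trans ?_
    rw [inv_pow, Real.sq_sqrt hM'.le, div_eq_inv_mul]
    have := mul_le_mul_of_nonneg_left (hmom 2 (by norm_num)) (inv_nonneg.2 hM'.le)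
    have h6 : 0 ≤ (M : ℝ)⁻¹ * (J / 2) := by positivity
    nlinarith
  · intro M hM
    have hM' : (0 : ℝ) < M := by exact_mod_cast hM
    refine ⟨?_, ?_⟩
    · rw [hs.excessBias_eq hh hM]
      exact integral_nonneg fun z => posPartShift_nonneg _ _ _
    · have h1 : (Real.sqrt M)⁻¹ ≤ 1 :=
        inv_le_one_of_one_le₀ (Real.one_le_sqrt.2 (by exact_mod_cast hM))
      have h2 := (abs_le.1 (hexp M hM)).2
      have h3 : 2 * C * (Real.sqrt M)⁻¹ / M ≤ 2 * C / M :=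
        div_le_div_of_nonneg_right (mul_le_of_le_one_right (by positivity) h1) hM'.le
      rw [add_div]; linarith
  · have hlim : Tendsto (fun M : ℕ => 2 * C * (Real.sqrt M)⁻¹) atTop (𝓝 0) := by
      have := (tendsto_inv_atTop_zero.comp
        (Real.tendsto_sqrt_atTop.comp tendsto_natCast_atTop_atTop)).const_mul (2 * C)
      simpa using this
    filter_upwards [hlim.eventually_lt_const (show 0 < J / 4 by positivity),
      eventually_ge_atTop 1] with M h1 hM
    have hM' : (0 : ℝ) < M := by exact_mod_cast hM
    have h2 := (abs_le.1 (hexp M hM)).1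
    have h3 : 2 * C * (Real.sqrt M)⁻¹ / M ≤ J / 4 / M := by gcongr
    have h4 : J / 2 / M = J / 4 / M + J / 4 / M := by ring
    linarith

end BiasBounds

/-! ### Asymptotic normality of the nested value-at-risk -/

section VaR

variable {P : Measure Θ} [IsProbabilityMeasure P] {κ : Kernel Θ Ξ} [IsMarkovKernel κ]
  {h : Θ → Ξ → ℝ} {μ : Measure Ω} [IsProbabilityMeasure μ] {θ : ℕ → Ω → Θ}
  {ξ : ℕ → ℕ → Ω → Ξ} {N M : ℕ → ℕ}

/-- The indicator of `H(θ) ≤ t`. -/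
def outerInd (κ : Kernel Θ Ξ) (h : Θ → Ξ → ℝ) (t : ℝ) (z : Θ × (ℕ → Ξ)) : ℝ :=
  (Set.Iic t).indicator 1 (meanResponse κ h z.1)

/-- The indicator of `Ĥ_M(θ) ≤ t`. -/
def innerInd (h : Θ → Ξ → ℝ) (M : ℕ) (t : ℝ) (z : Θ × (ℕ → Ξ)) : ℝ :=
  (Set.Iic t).indicator 1 (sampleMean h M z.1 z.2)

/-- The `i`-th scenario together with its inner noises. -/
def block (θ : ℕ → Ω → Θ) (ξ : ℕ → ℕ → Ω → Ξ) (i : ℕ) (ω : Ω) : Θ × (ℕ → Ξ) :=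
  (θ i ω, fun j => ξ i j ω)

theorem measurable_outerInd (hh : Measurable (Function.uncurry h)) (t : ℝ) :
    Measurable (outerInd κ h t) :=
  (measurable_one.indicator measurableSet_Iic).comp
    ((measurable_meanResponse hh).comp measurable_fst)

theorem measurable_innerInd (hh : Measurable (Function.uncurry h)) (M : ℕ) (t : ℝ) :
    Measurable (innerInd h M t) :=
  (measurable_one.indicator measurableSet_Iic).comp (measurable_sampleMean hh M)

theorem abs_indicator_one_le (s : Set ℝ) (x : ℝ) : |s.indicator (1 : ℝ → ℝ) x| ≤ 1 := by
  by_cases hx : x ∈ s <;> simp [hx]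

theorem memLp_outerInd (hh : Measurable (Function.uncurry h)) (t : ℝ) :
    MemLp (outerInd κ h t) 2 (scenarioLaw P κ) :=
  MemLp.of_bound (measurable_outerInd hh t).aestronglyMeasurable 1
    (ae_of_all _ fun _ => abs_indicator_one_le _ _)

theorem memLp_innerInd (hh : Measurable (Function.uncurry h)) (M : ℕ) (t : ℝ) :
    MemLp (innerInd h M t) 2 (scenarioLaw P κ) :=
  MemLp.of_bound (measurable_innerInd hh M t).aestronglyMeasurable 1
    (ae_of_all _ fun _ => abs_indicator_one_le _ _)

theorem integral_outerInd (hh : Measurable (Function.uncurry h)) (t : ℝ) :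
    ∫ z, outerInd κ h t z ∂(scenarioLaw P κ) = P.real {θ | meanResponse κ h θ ≤ t} := by
  have hH : MeasurableSet {θ | meanResponse κ h θ ≤ t} :=
    measurableSet_le (measurable_meanResponse hh) measurable_const
  have hX : MeasurableSet {z : Θ × (ℕ → Ξ) | meanResponse κ h z.1 ≤ t} :=
    hH.preimage measurable_fst
  rw [← measureReal_fst (κ := κ) hH, ← integral_indicator_one hX]
  rfl

theorem integral_innerInd (hh : Measurable (Function.uncurry h)) (M : ℕ) (t : ℝ) :
    ∫ z, innerInd h M t z ∂(scenarioLaw P κ) =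
      (scenarioLaw P κ).real {z | sampleMean h M z.1 z.2 ≤ t} := by
  have hA : MeasurableSet {z : Θ × (ℕ → Ξ) | sampleMean h M z.1 z.2 ≤ t} :=
    measurableSet_le (measurable_sampleMean hh M) measurable_const
  rw [← integral_indicator_one hA]
  rfl

theorem IsNestedSample.measurable_block (hn : IsNestedSample P κ μ θ ξ) (i : ℕ) :
    Measurable (block θ ξ i) :=
  (hn.measurable_scenario i).prodMk (measurable_pi_lambda _ fun j => hn.measurable_noise i j)

theorem IsNestedSample.measurable_nestedMeans (hn : IsNestedSample P κ μ θ ξ)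
    (hh : Measurable (Function.uncurry h)) (N M : ℕ) (i : Fin N) :
    Measurable fun ω => nestedMeans h θ ξ N M ω i :=
  (measurable_sampleMean hh M).comp (hn.measurable_block i)

theorem countLE_nestedMeans {N : ℕ} (hN : 0 < N) (M : ℕ) (t : ℝ) (ω : Ω) :
    countLE (nestedMeans h θ ξ N M ω) t =
      Real.sqrt N * normalizedSum (scenarioLaw P κ) (block θ ξ) N (innerInd h M t) ω +
        N * ∫ z, innerInd h M t z ∂(scenarioLaw P κ) := by
  rw [← sum_eq_normalizedSum hN]
  exact Fin.sum_univ_eq_sum_range (fun i => innerInd h M t (block θ ξ i ω)) N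

/-- The indicators of `Ĥ_M(θ) ≤ t` tend to that of `H(θ) ≤ v` in mean square. -/
theorem StrongAssumption.tendsto_integral_innerInd_sub_sq (hs : StrongAssumption P κ h)
    (hh : Measurable (Function.uncurry h)) {v : ℝ}
    (hF : Continuous fun t => P.real {θ | meanResponse κ h θ ≤ t}) (hM : Tendsto M atTop atTop)
    {t : ℕ → ℝ} (ht : Tendsto t atTop (𝓝 v)) :
    Tendsto (fun k => ∫ z, (innerInd h (M k) (t k) z - outerInd κ h v z) ^ 2 ∂(scenarioLaw P κ))
      atTop (𝓝 0) := by
  set V := ∫ θ, responseVariance κ h θ ∂P with hV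
  have hint : ∀ a, Integrable (outerInd κ h a) (scenarioLaw P κ) := fun a =>
    (memLp_outerInd hh a).integrable one_le_two
  rw [Metric.tendsto_nhds]
  intro ε hε
  -- Continuity of the distribution function makes the probability of `v - η < H ≤ v + η` small.
  have hlim : Tendsto (fun η => P.real {θ | meanResponse κ h θ ≤ v + η} -
      P.real {θ | meanResponse κ h θ ≤ v - η}) (𝓝[>] 0) (𝓝 0) := by
    have h1 : Continuous fun η : ℝ => P.real {θ | meanResponse κ h θ ≤ v + η} -
        P.real {θ | meanResponse κ h θ ≤ v - η} :=
      (hF.comp (by fun_prop : Continuous fun η : ℝ => v + η)).sub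
        (hF.comp (by fun_prop : Continuous fun η : ℝ => v - η))
    have h2 := h1.tendsto 0
    simp only [add_zero, sub_zero, sub_self] at h2
    exact h2.mono_left nhdsWithin_le_nhds
  obtain ⟨η, hη1, hη0⟩ := ((hlim.eventually_lt_const (half_pos hε)).and
    self_mem_nhdsWithin).exists
  have hη0' : 0 < η := hη0
  have htail : Tendsto (fun k => 4 / η ^ 2 * (V / M k)) atTop (𝓝 0) := by
    have := ((tendsto_const_nhds (x := V)).div_atTop
      (tendsto_natCast_atTop_atTop.comp hM)).const_mul (4 / η ^ 2)
    simpa using this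
  have htη : ∀ᶠ k in atTop, |t k - v| < η / 2 := by
    have := Metric.tendsto_nhds.1 ht (η / 2) (half_pos hη0')
    simpa [Real.dist_eq] using this
  filter_upwards [htail.eventually_lt_const (half_pos hε), htη, hM.eventually_ge_atTop 1]
    with k hk1 hk2 hk3
  rw [Real.dist_eq, sub_zero, abs_of_nonneg (integral_nonneg fun _ => sq_nonneg _)]
  have herr : MemLp (sampleError κ h (M k)) 2 (scenarioLaw P κ) :=
    (hs.memLp_sampleMean hh hk3).sub (hs.memLp_fst hh)
  -- Since `|t k - v| < η / 2`, the indicators can differ only if `H` is within `η` of `v` or the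
  -- inner error is at least `η / 2`. The latter indicator is at most `4 / η ^ 2` times the squared
  -- error.
  have hle : ∀ z, (innerInd h (M k) (t k) z - outerInd κ h v z) ^ 2 ≤
      (outerInd κ h (v + η) z - outerInd κ h (v - η) z) +
        4 / η ^ 2 * sampleError κ h (M k) z ^ 2 := by
    intro z
    have hsq : η / 2 ≤ |sampleError κ h (M k) z| →
        1 ≤ 4 / η ^ 2 * sampleError κ h (M k) z ^ 2 := by
      intro hz
      have h1 : (η / 2) ^ 2 ≤ sampleError κ h (M k) z ^ 2 := by
        rw [← sq_abs (sampleError κ h (M k) z)]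
        gcongr
      calc (1 : ℝ) = 4 / η ^ 2 * (η / 2) ^ 2 := by field_simp; norm_num
        _ ≤ _ := by gcongr
    have hnn : 0 ≤ 4 / η ^ 2 * sampleError κ h (M k) z ^ 2 := by positivity
    obtain ⟨hk4, hk5⟩ := abs_lt.1 hk2
    simp only [innerInd, outerInd, Set.indicator_apply, Set.mem_Iic, Pi.one_apply]
    have hA : sampleMean h (M k) z.1 z.2 = meanResponse κ h z.1 + sampleError κ h (M k) z := by
      simp [sampleError]
    rw [hA]
    generalize meanResponse κ h z.1 = x at *
    generalize sampleError κ h (M k) z = e at *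
    have hsq' : (x ≤ v - η ∨ v + η < x) → ¬ (x + e ≤ t k ↔ x ≤ v) → 1 ≤ 4 / η ^ 2 * e ^ 2 := by
      intro h1 h2
      refine hsq ?_
      by_contra hlt
      obtain ⟨h3, h4⟩ := abs_lt.1 (not_le.1 hlt)
      apply h2
      rcases h1 with h1 | h1
      · exact ⟨fun _ => by linarith, fun _ => by linarith⟩
      · exact ⟨fun h => by linarith, fun h => by linarith⟩
    by_cases hxy : (x + e ≤ t k ↔ x ≤ v)
    · have : (if x + e ≤ t k then (1 : ℝ) else 0) = if x ≤ v then 1 else 0 := by simp [hxy]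
      rw [this, sub_self]
      split_ifs <;> nlinarith
    · have h1 : ((if x + e ≤ t k then (1 : ℝ) else 0) - if x ≤ v then 1 else 0) ^ 2 ≤ 1 := by
        split_ifs <;> norm_num
      refine h1.trans ?_
      by_cases h2 : x ≤ v - η
      · have := hsq' (Or.inl h2) hxy
        rw [if_pos h2, if_pos (by linarith)]; linarith
      · by_cases h3 : x ≤ v + η
        · rw [if_neg h2, if_pos h3]; linarith
        · have := hsq' (Or.inr (not_le.1 h3)) hxy
          rw [if_neg h2, if_neg h3]; linarith
  have hmono := integral_mono
    (((memLp_innerInd (P := P) (κ := κ) hh (M k) (t k)).sub (memLp_outerInd hh v)).integrable_sq)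
    (((hint _).sub (hint _)).add (herr.integrable_sq.const_mul _)) hle
  refine lt_of_le_of_lt hmono ?_
  rw [integral_add' ((hint _).sub (hint _)) (herr.integrable_sq.const_mul _),
    integral_sub' (hint _) (hint _), integral_const_mul, hs.integral_sampleError_sq hh hk3,
    integral_outerInd hh, integral_outerInd hh]
  linarith

theorem variance_outerInd (hh : Measurable (Function.uncurry h)) {v α : ℝ}
    (hv : P.real {θ | meanResponse κ h θ ≤ v} = α) :
    variance (outerInd κ h v) (scenarioLaw P κ) = α * (1 - α) := by
  rw [variance_eq_sub (memLp_outerInd hh v), integral_outerInd hh, hv]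
  have : outerInd κ h v ^ 2 = outerInd κ h v := by
    ext z
    simp only [Pi.pow_apply, outerInd]
    by_cases hz : meanResponse κ h z.1 ∈ Set.Iic v
    · simp [Set.indicator_of_mem hz]
    · simp [Set.indicator_of_notMem hz]
  rw [this, integral_outerInd hh, hv]
  ring

/-- Asymptotic normality of the nested value-at-risk estimator when the bias is negligible. -/
theorem tendstoInDistribution_nestedVaR (hs : StrongAssumption P κ h)
    (hh : Measurable (Function.uncurry h)) (hn : IsNestedSample P κ μ θ ξ) {f : ℝ → ℝ}
    (hf : IsDensityOf f P (meanResponse κ h)) {α : ℝ} (hα0 : 0 < α) (hα1 : α < 1)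
    (hc : ContinuousAt f (VaR P (meanResponse κ h) α))
    (hpos : 0 < f (VaR P (meanResponse κ h) α))
    (hN : Tendsto N atTop atTop) (hM : Tendsto M atTop atTop)
    (hNM : Tendsto (fun k => Real.sqrt (N k) / M k) atTop (𝓝 0)) :
    TendstoInDistribution
      (fun k ω => Real.sqrt (N k) *
        (nestedVaR h θ ξ α (N k) (M k) ω - VaR P (meanResponse κ h) α)) atTop
      (fun z : ℝ => sigmaV P (meanResponse κ h) f α * z) (fun _ => μ) (gaussianReal 0 1) := by
  have hH := measurable_meanResponse (κ := κ) hh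
  set v := VaR P (meanResponse κ h) α with hv
  have hFv : P.real {θ | meanResponse κ h θ ≤ v} = α := hf.cdf_VaR hH hα0 hα1
  obtain ⟨C, -, -, hbias, -, -⟩ := hs.exists_bias_bounds hh hf hc hpos
  have hsqrt : Tendsto (fun k => Real.sqrt (N k)) atTop atTop :=
    Real.tendsto_sqrt_atTop.comp (tendsto_natCast_atTop_atTop.comp hN)
  set t : ℝ → ℕ → ℝ := fun y k => v + (Real.sqrt (N k))⁻¹ * y with ht
  have htv : ∀ y, Tendsto (t y) atTop (𝓝 v) := fun y => by
    have := (hsqrt.inv_tendsto_atTop.mul_const y).const_add v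
    simpa using this
  -- The deterministic drift at the local level `v + y / √N`. The derivative of the distribution
  -- function gives the limit `f v * y`, and the bias contributes at most `C √N / M`; only here does
  -- `hNM` enter.
  set r : ℝ → ℕ → ℝ := fun y k => Real.sqrt (N k) *
    (∫ z, innerInd h (M k) (t y k) z ∂(scenarioLaw P κ) - α) with hr
  have hrlim : ∀ y, Tendsto (r y) atTop (𝓝 (f v * y)) := by
    intro y
    have h1 := ((hf.hasDerivAt_cdf hH hc).hasFDerivAt.lim_real y).comp hsqrt
    simp only [ContinuousLinearMap.toSpanSingleton_apply, smul_eq_mul, hFv] at h1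
    have h2 : Tendsto (fun k => r y k - Real.sqrt (N k) *
        (P.real {θ | meanResponse κ h θ ≤ t y k} - α)) atTop (𝓝 0) := by
      have h3 := hNM.const_mul C
      rw [mul_zero] at h3
      refine squeeze_zero_norm' ?_ h3
      filter_upwards [hM.eventually_ge_atTop 1] with k hk
      rw [hr]
      simp only
      rw [← mul_sub, sub_sub_sub_cancel_right, integral_innerInd hh, norm_mul,
        Real.norm_of_nonneg (Real.sqrt_nonneg _)]
      refine (mul_le_mul_of_nonneg_left (hbias (M k) hk (t y k)) (Real.sqrt_nonneg _)).trans
        (le_of_eq ?_)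
      ring
    have h4 := h2.add h1
    rw [zero_add, mul_comm y] at h4
    refine h4.congr fun k => ?_
    simp [ht]
  have hψ : ∀ y, TendstoInMeasure μ (fun k => normalizedSum (scenarioLaw P κ) (block θ ξ) (N k)
      (fun z => innerInd h (M k) (t y k) z - outerInd κ h v z)) atTop 0 := fun y =>
    tendstoInMeasure_normalizedSum hn.measurable_block hn.indep hn.law N
      (fun k => (measurable_innerInd hh _ _).sub (measurable_outerInd hh _))
      (Eventually.of_forall fun k => (memLp_innerInd hh _ _).sub (memLp_outerInd hh _))
      (hs.tendsto_integral_innerInd_sub_sq hh (hf.continuous_cdf hH) hM (htv y))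
  have hψ' : ∀ y k ω, normalizedSum (scenarioLaw P κ) (block θ ξ) (N k)
      (fun z => innerInd h (M k) (t y k) z - outerInd κ h v z) ω =
      normalizedSum (scenarioLaw P κ) (block θ ξ) (N k) (innerInd h (M k) (t y k)) ω -
        normalizedSum (scenarioLaw P κ) (block θ ξ) (N k) (outerInd κ h v) ω := fun y k ω =>
    normalizedSum_sub ((memLp_innerInd hh _ _).integrable one_le_two)
      ((memLp_outerInd hh _).integrable one_le_two) _ _
  -- the linear statistic to which the estimator is asymptotically equivalent
  have hU : TendstoInDistribution (fun k => normalizedSum (scenarioLaw P κ) (block θ ξ) (N k)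
      (fun z => -(f v)⁻¹ * outerInd κ h v z)) atTop
      (fun z : ℝ => sigmaV P (meanResponse κ h) f α * z) (fun _ => μ) (gaussianReal 0 1) := by
    have := tendstoInDistribution_normalizedSum hn.measurable_block hn.indep hn.law hN
      ((measurable_outerInd (κ := κ) hh v).const_mul (-(f v)⁻¹))
      ((memLp_outerInd hh v).const_mul (-(f v)⁻¹))
    have hσ : Real.sqrt (variance (fun z => -(f v)⁻¹ * outerInd κ h v z) (scenarioLaw P κ)) =
        sigmaV P (meanResponse κ h) f α := by
      rw [variance_const_mul, variance_outerInd hh hFv, sigmaV, ← hv,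
        Real.sqrt_mul (sq_nonneg _), Real.sqrt_sq_eq_abs, abs_neg, abs_of_pos (inv_pos.2 hpos)]
      ring
    rwa [hσ] at this
  -- The counting criterion `α N ≤ countLE`, centered and divided by `√N`.
  have hlevel : ∀ y, ∀ᶠ k in atTop, ∀ ω, Real.sqrt (N k) *
      (nestedVaR h θ ξ α (N k) (M k) ω - v) ≤ y ↔ -r y k ≤
        normalizedSum (scenarioLaw P κ) (block θ ξ) (N k) (innerInd h (M k) (t y k)) ω := by
    intro y
    filter_upwards [hN.eventually_ge_atTop 1] with k hk ω
    have hNk : (0 : ℝ) < N k := by exact_mod_cast hk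
    have hsk : 0 < Real.sqrt (N k) := Real.sqrt_pos.2 hNk
    have e1 : Real.sqrt (N k) * (nestedVaR h θ ξ α (N k) (M k) ω - v) ≤ y ↔
        nestedVaR h θ ξ α (N k) (M k) ω ≤ t y k := by
      rw [← le_div_iff₀' hsk, sub_le_iff_le_add', div_eq_inv_mul]
    rw [e1, nestedVaR, varEstimator_le_iff hα0 hα1 hk, countLE_nestedMeans (P := P) (κ := κ) hk]
    have e2 : (N k : ℝ) = Real.sqrt (N k) * Real.sqrt (N k) := (Real.mul_self_sqrt hNk.le).symm
    rw [← sub_nonneg, ← sub_nonneg (b := -r y k)]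
    have e3 : Real.sqrt (N k) * normalizedSum (scenarioLaw P κ) (block θ ξ) (N k)
        (innerInd h (M k) (t y k)) ω + N k * ∫ z, innerInd h (M k) (t y k) z ∂(scenarioLaw P κ) -
        α * N k = Real.sqrt (N k) * (normalizedSum (scenarioLaw P κ) (block θ ξ) (N k)
        (innerInd h (M k) (t y k)) ω - -r y k) := by
      rw [hr]
      linear_combination
        (∫ z, innerInd h (M k) (t y k) z ∂(scenarioLaw P κ) - α) * e2
    rw [e3, mul_nonneg_iff_of_pos_left hsk]
  refine tendstoInDistribution_of_levels hU (fun k => ?_) ?_ ?_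
  · exact ((measurable_varEstimator hα0 hα1 (hn.measurable_nestedMeans hh _ _)).sub_const _
      |>.const_mul _).aemeasurable
  · intro y y' hyy'
    -- On this event the inner and outer sums differ by at least `f v * (y' - y) - ε`; half of the
    -- gap absorbs the error in the limit of `r`.
    set ε := f v * (y' - y) / 2 with hε
    have hε0 : 0 < ε := by have := sub_pos.2 hyy'; positivity
    refine tendsto_measureReal_zero_of_subset (tendstoInMeasure_zero_iff.1 (hψ y) ε hε0) ?_
    filter_upwards [hlevel y, (hrlim y).eventually_lt_const (show f v * y < f v * y + ε by
      linarith)] with k hk1 hk2 ω hω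
    obtain ⟨h1, h2⟩ := hω
    rw [hk1] at h1
    rw [normalizedSum_const_mul, neg_mul, ← div_eq_inv_mul, le_neg, div_le_iff₀ hpos] at h2
    simp only [Set.mem_ofPred_eq, hψ']
    refine le_trans ?_ (le_abs_self _)
    have : ε + ε = f v * y' - f v * y := by rw [hε]; ring
    linarith
  · intro y y' hyy'
    -- The level equivalence describes `V ≤ m`, and its negation is strict, so a level strictly
    -- below `y'` is needed.
    set m := (y + y') / 2 with hm
    set ε := f v * (m - y) / 2 with hε
    have hym : 0 < m - y := by rw [hm]; linarith
    have hε0 : 0 < ε := by positivity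
    refine tendsto_measureReal_zero_of_subset (tendstoInMeasure_zero_iff.1 (hψ m) ε hε0) ?_
    filter_upwards [hlevel m, (hrlim m).eventually_const_lt (show f v * m - ε < f v * m by
      linarith)] with k hk1 hk2 ω hω
    obtain ⟨h1, h2⟩ := hω
    have h3 : ¬ _ := fun h => absurd ((hk1 ω).2 h) (not_le.2 (by linarith))
    rw [not_le] at h3
    rw [normalizedSum_const_mul, neg_mul, ← div_eq_inv_mul, neg_le, le_div_iff₀ hpos] at h1
    simp only [Set.mem_ofPred_eq, hψ']
    refine le_trans ?_ (neg_le_abs _)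
    have : ε + ε = f v * m - f v * y := by rw [hε]; ring
    linarith

end VaR

/-! ### Linearization of the nested conditional value-at-risk -/

section CVaR

variable {P : Measure Θ} [IsProbabilityMeasure P] {κ : Kernel Θ Ξ} [IsMarkovKernel κ]
  {h : Θ → Ξ → ℝ} {μ : Measure Ω} [IsProbabilityMeasure μ] {θ : ℕ → Ω → Θ}
  {ξ : ℕ → ℕ → Ω → Ξ} {N M : ℕ → ℕ}

/-- The excess `(H(θ) - v)⁺`. -/
def outerExcess (κ : Kernel Θ Ξ) (h : Θ → Ξ → ℝ) (v : ℝ) (z : Θ × (ℕ → Ξ)) : ℝ :=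
  max (meanResponse κ h z.1 - v) 0

/-- The excess `(Ĥ_M(θ) - v)⁺`. -/
def innerExcess (h : Θ → Ξ → ℝ) (M : ℕ) (v : ℝ) (z : Θ × (ℕ → Ξ)) : ℝ :=
  max (sampleMean h M z.1 z.2 - v) 0

theorem measurable_outerExcess (hh : Measurable (Function.uncurry h)) (v : ℝ) :
    Measurable (outerExcess κ h v) :=
  (((measurable_meanResponse hh).comp measurable_fst).sub_const v).max measurable_const

theorem measurable_innerExcess (hh : Measurable (Function.uncurry h)) (M : ℕ) (v : ℝ) :
    Measurable (innerExcess h M v) :=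
  ((measurable_sampleMean hh M).sub_const v).max measurable_const

theorem StrongAssumption.memLp_outerExcess (hs : StrongAssumption P κ h)
    (hh : Measurable (Function.uncurry h)) (v : ℝ) :
    MemLp (outerExcess κ h v) 2 (scenarioLaw P κ) :=
  memLp_posPart (hs.memLp_fst hh) v

theorem StrongAssumption.memLp_innerExcess (hs : StrongAssumption P κ h)
    (hh : Measurable (Function.uncurry h)) {M : ℕ} (hM : 1 ≤ M) (v : ℝ) :
    MemLp (innerExcess h M v) 2 (scenarioLaw P κ) :=
  memLp_posPart (hs.memLp_sampleMean hh hM) v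

/-- The positive part is 1-Lipschitz, so the mean square is at most that of the inner error, a
constant over `M`. -/
theorem StrongAssumption.tendsto_integral_innerExcess_sub_sq (hs : StrongAssumption P κ h)
    (hh : Measurable (Function.uncurry h)) (v : ℝ) (hM : Tendsto M atTop atTop) :
    Tendsto (fun k => ∫ z, (innerExcess h (M k) v z - outerExcess κ h v z) ^ 2 ∂(scenarioLaw P κ))
      atTop (𝓝 0) := by
  have hlim : Tendsto (fun k => (∫ θ, responseVariance κ h θ ∂P) / M k) atTop (𝓝 0) :=
    tendsto_const_nhds.div_atTop (tendsto_natCast_atTop_atTop.comp hM)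
  refine squeeze_zero' (Eventually.of_forall fun k => integral_nonneg fun z => sq_nonneg _) ?_ hlim
  filter_upwards [hM.eventually_ge_atTop 1] with k hk
  rw [← hs.integral_sampleError_sq hh hk]
  refine integral_mono ((hs.memLp_innerExcess hh hk v).sub (hs.memLp_outerExcess hh v)).integrable_sq
    ((hs.memLp_sampleMean hh hk).sub (hs.memLp_fst hh)).integrable_sq fun z => ?_
  rw [sq_le_sq]
  refine (abs_max_sub_max_le_abs _ _ _).trans (le_of_eq ?_)
  congr 1
  simp [sampleError]

/-- A weak law of large numbers that needs no relation between `N` and `M`, and so is available in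
both directions of the theorem: the fluctuation has second moment at most `1 / N`, and the bias is
`O(1 / M)`. -/
theorem tendstoInMeasure_countLE (hs : StrongAssumption P κ h)
    (hh : Measurable (Function.uncurry h)) (hn : IsNestedSample P κ μ θ ξ) {f : ℝ → ℝ}
    (hf : IsDensityOf f P (meanResponse κ h)) {α : ℝ} (hα0 : 0 < α) (hα1 : α < 1)
    (hc : ContinuousAt f (VaR P (meanResponse κ h) α))
    (hpos : 0 < f (VaR P (meanResponse κ h) α))
    (hN : Tendsto N atTop atTop) (hM : Tendsto M atTop atTop) :
    TendstoInMeasure μ (fun k ω => countLE (nestedMeans h θ ξ (N k) (M k) ω)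
      (VaR P (meanResponse κ h) α) / N k - α) atTop 0 := by
  have hH := measurable_meanResponse (κ := κ) hh
  set v := VaR P (meanResponse κ h) α with hv
  have hFv : P.real {θ | meanResponse κ h θ ≤ v} = α := hf.cdf_VaR hH hα0 hα1
  obtain ⟨C, -, -, hbias, -, -⟩ := hs.exists_bias_bounds hh hf hc hpos
  have hinv : Tendsto (fun k => ((N k : ℝ))⁻¹) atTop (𝓝 0) :=
    (tendsto_natCast_atTop_atTop.comp hN).inv_tendsto_atTop
  -- The additional factor `1 / √N` is put into the summand, whose mean square then tends to zero.
  have h1 : TendstoInMeasure μ (fun k => normalizedSum (scenarioLaw P κ) (block θ ξ) (N k)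
      (fun z => (Real.sqrt (N k))⁻¹ * innerInd h (M k) v z)) atTop 0 := by
    refine tendstoInMeasure_normalizedSum hn.measurable_block hn.indep hn.law N
      (fun k => (measurable_innerInd hh _ _).const_mul _)
      (Eventually.of_forall fun k => (memLp_innerInd hh _ _).const_mul _) ?_
    refine squeeze_zero (fun k => integral_nonneg fun z => sq_nonneg _) (fun k => ?_) hinv
    have hle : ∀ z, ((Real.sqrt (N k))⁻¹ * innerInd h (M k) v z) ^ 2 ≤ ((N k : ℝ))⁻¹ := by
      intro z
      rw [mul_pow, inv_pow, Real.sq_sqrt (Nat.cast_nonneg _)]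
      refine mul_le_of_le_one_right (by positivity) ?_
      rw [sq_le_one_iff_abs_le_one]
      exact abs_indicator_one_le _ _
    refine (integral_mono ((memLp_innerInd hh _ _).const_mul _).integrable_sq
      (integrable_const _) hle).trans (le_of_eq ?_)
    simp
  have h2 : Tendsto (fun k => ∫ z, innerInd h (M k) v z ∂(scenarioLaw P κ) - α) atTop (𝓝 0) := by
    have h3 : Tendsto (fun k => C / (M k : ℝ)) atTop (𝓝 0) :=
      tendsto_const_nhds.div_atTop (tendsto_natCast_atTop_atTop.comp hM)
    refine squeeze_zero_norm' ?_ h3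
    filter_upwards [hM.eventually_ge_atTop 1] with k hk
    rw [integral_innerInd hh, ← hFv]
    exact hbias (M k) hk v
  refine tendstoInMeasure_zero_of_le (tendstoInMeasure_zero_add h1
    (tendstoInMeasure_zero_of_tendsto h2)) ?_
  filter_upwards [hN.eventually_ge_atTop 1] with k hk ω
  have hNk : (0 : ℝ) < N k := by exact_mod_cast hk
  have hsk : 0 < Real.sqrt (N k) := Real.sqrt_pos.2 hNk
  refine le_of_eq (congrArg _ ?_)
  rw [countLE_nestedMeans (P := P) (κ := κ) hk, normalizedSum_const_mul]
  have e2 : Real.sqrt (N k) ^ 2 = N k := Real.sq_sqrt hNk.le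
  field_simp
  linear_combination normalizedSum (scenarioLaw P κ) (block θ ξ) (N k) (innerInd h (M k) v) ω * e2

theorem empiricalObjective_nestedMeans {α : ℝ} {N : ℕ} (hN : 0 < N) (M : ℕ) (v : ℝ) (ω : Ω) :
    empiricalObjective α (nestedMeans h θ ξ N M ω) v = v + 1 / (1 - α) *
      ((Real.sqrt N)⁻¹ * normalizedSum (scenarioLaw P κ) (block θ ξ) N (innerExcess h M v) ω +
        ∫ z, innerExcess h M v z ∂(scenarioLaw P κ)) := by
  have hN' : (0 : ℝ) < N := by exact_mod_cast hN
  have hs : 0 < Real.sqrt N := Real.sqrt_pos.2 hN'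
  have h1 : ∑ i, max (nestedMeans h θ ξ N M ω i - v) 0 = Real.sqrt N *
      normalizedSum (scenarioLaw P κ) (block θ ξ) N (innerExcess h M v) ω +
        N * ∫ z, innerExcess h M v z ∂(scenarioLaw P κ) := by
    rw [← sum_eq_normalizedSum hN]
    exact Fin.sum_univ_eq_sum_range (fun i => innerExcess h M v (block θ ξ i ω)) N
  have e1 : Real.sqrt N / N = (Real.sqrt N)⁻¹ := Real.sqrt_div_self
  rw [empiricalObjective, h1, ← e1, one_div_mul_eq_div, one_div_mul_eq_div, mul_comm (1 - α),
    ← div_div]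
  congr 2
  field_simp

theorem CVaR_eq (hh : Measurable (Function.uncurry h)) (α : ℝ) :
    CVaR P (meanResponse κ h) α = VaR P (meanResponse κ h) α + 1 / (1 - α) *
      ∫ z, outerExcess κ h (VaR P (meanResponse κ h) α) z ∂(scenarioLaw P κ) := by
  rw [CVaR]
  congr 2
  have hm : Measurable fun θ => max (meanResponse κ h θ - VaR P (meanResponse κ h) α) 0 :=
    ((measurable_meanResponse hh).sub_const _).max measurable_const
  exact ((MeasurePreserving.hasLaw ⟨measurable_fst,
    Measure.fst_compProd P (iidKernel κ)⟩).integral_comp hm.aestronglyMeasurable).symm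

theorem sigmaC_eq (hh : Measurable (Function.uncurry h)) {α : ℝ} (hα1 : α < 1) :
    sigmaC P (meanResponse κ h) α = Real.sqrt (variance (fun z => 1 / (1 - α) *
      outerExcess κ h (VaR P (meanResponse κ h) α) z) (scenarioLaw P κ)) := by
  have hm : Measurable fun θ => max (meanResponse κ h θ - VaR P (meanResponse κ h) α) 0 :=
    ((measurable_meanResponse hh).sub_const _).max measurable_const
  have hvar : variance (outerExcess κ h (VaR P (meanResponse κ h) α)) (scenarioLaw P κ) =
      variance (fun θ => max (meanResponse κ h θ - VaR P (meanResponse κ h) α) 0) P :=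
    MeasurePreserving.variance_fun_comp ⟨measurable_fst, Measure.fst_compProd P (iidKernel κ)⟩
      hm.aemeasurable
  rw [variance_const_mul, hvar, Real.sqrt_mul (sq_nonneg _), Real.sqrt_sq_eq_abs,
    abs_of_pos (one_div_pos.2 (sub_pos.2 hα1)), sigmaC]
  ring

/-- The difference between the normalized error of the nested conditional value-at-risk estimator
and its linear and bias parts tends to zero in probability. -/
theorem tendstoInMeasure_nestedCVaR_remainder (hs : StrongAssumption P κ h)
    (hh : Measurable (Function.uncurry h)) (hn : IsNestedSample P κ μ θ ξ) {f : ℝ → ℝ}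
    (hf : IsDensityOf f P (meanResponse κ h)) {α : ℝ} (hα0 : 0 < α) (hα1 : α < 1)
    (hc : ContinuousAt f (VaR P (meanResponse κ h) α))
    (hpos : 0 < f (VaR P (meanResponse κ h) α))
    (hN : Tendsto N atTop atTop) (hM : Tendsto M atTop atTop)
    {Z : ℝ → ℝ} (hV : TendstoInDistribution
      (fun k ω => Real.sqrt (N k) *
        (nestedVaR h θ ξ α (N k) (M k) ω - VaR P (meanResponse κ h) α)) atTop
      Z (fun _ => μ) (gaussianReal 0 1)) :
    TendstoInMeasure μ (fun k ω => Real.sqrt (N k) *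
        (nestedCVaR h θ ξ α (N k) (M k) ω - CVaR P (meanResponse κ h) α) -
        normalizedSum (scenarioLaw P κ) (block θ ξ) (N k)
          (fun z => 1 / (1 - α) * outerExcess κ h (VaR P (meanResponse κ h) α) z) ω -
        Real.sqrt (N k) * (1 / (1 - α) *
          excessBias P κ h (M k) (VaR P (meanResponse κ h) α))) atTop 0 := by
  set v := VaR P (meanResponse κ h) α with hv
  have hα : 0 < 1 - α := sub_pos.2 hα1
  have h1 : TendstoInMeasure μ (fun k => normalizedSum (scenarioLaw P κ) (block θ ξ) (N k)
      (fun z => innerExcess h (M k) v z - outerExcess κ h v z)) atTop 0 :=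
    tendstoInMeasure_normalizedSum hn.measurable_block hn.indep hn.law N
      (fun k => (measurable_innerExcess hh _ _).sub (measurable_outerExcess hh _))
      ((hM.eventually_ge_atTop 1).mono fun k hk =>
        (hs.memLp_innerExcess hh hk v).sub (hs.memLp_outerExcess hh v))
      (hs.tendsto_integral_innerExcess_sub_sq hh v hM)
  -- The limit `Z` serves only to make `√N (ṽ - v)` tight; the other factor, `F_N(v) - α`, tends to
  -- zero.
  have h2 := tendstoInMeasure_zero_const_mul (1 / (1 - α)) (tendstoInMeasure_zero_mul hV
    (tendstoInMeasure_countLE hs hh hn hf hα0 hα1 hc hpos hN hM))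
  have h3 : ∀ {Y : ℕ → Ω → ℝ}, TendstoInMeasure μ Y atTop 0 →
      TendstoInMeasure μ (fun k ω => |Y k ω|) atTop 0 := fun hY =>
    tendstoInMeasure_zero_of_le hY (Eventually.of_forall fun k ω => (abs_abs _).le)
  refine tendstoInMeasure_zero_of_le (tendstoInMeasure_zero_add
    (h3 (tendstoInMeasure_zero_const_mul (1 / (1 - α)) h1)) (h3 h2)) ?_
  filter_upwards [hN.eventually_ge_atTop 1, hM.eventually_ge_atTop 1] with k hk hMk ω
  have hNk : (0 : ℝ) < N k := by exact_mod_cast hk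
  have hsk : 0 < Real.sqrt (N k) := Real.sqrt_pos.2 hNk
  rw [normalizedSum_sub ((hs.memLp_innerExcess hh hMk v).integrable one_le_two)
    ((hs.memLp_outerExcess hh v).integrable one_le_two), normalizedSum_const_mul]
  have hG := empiricalObjective_nestedMeans (P := P) (κ := κ) (h := h) (θ := θ) (ξ := ξ)
    (α := α) hk (M k) v ω
  have hle := cvarEstimator_le_empiricalObjective hα0 hα1 hk
    (nestedMeans h θ ξ (N k) (M k) ω) v
  have hge := le_cvarEstimator hα1 hk (nestedMeans h θ ξ (N k) (M k) ω) v
  have hC := CVaR_eq (P := P) (κ := κ) hh α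
  rw [← hv] at hC
  have hbias : excessBias P κ h (M k) v = ∫ z, innerExcess h (M k) v z ∂(scenarioLaw P κ) -
    ∫ z, outerExcess κ h v z ∂(scenarioLaw P κ) := rfl
  change empiricalObjective α (nestedMeans h θ ξ (N k) (M k) ω) v -
    |_| * |nestedVaR h θ ξ α (N k) (M k) ω - v| ≤ nestedCVaR h θ ξ α (N k) (M k) ω at hge
  change nestedCVaR h θ ξ α (N k) (M k) ω ≤ _ at hle
  set G := empiricalObjective α (nestedMeans h θ ξ (N k) (M k) ω) v
  set c := nestedCVaR h θ ξ α (N k) (M k) ω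
  set q := nestedVaR h θ ξ α (N k) (M k) ω
  set s := countLE (nestedMeans h θ ξ (N k) (M k) ω) v / N k - α
  set A := normalizedSum (scenarioLaw P κ) (block θ ξ) (N k) (innerExcess h (M k) v) ω
  set B := normalizedSum (scenarioLaw P κ) (block θ ξ) (N k) (outerExcess κ h v) ω
  -- The remainder splits into the centered effect of replacing `H` by `Ĥ_M` in the excess, and the
  -- effect of replacing the sample quantile by `v`.
  have hkey : Real.sqrt (N k) * (c - CVaR P (meanResponse κ h) α) - 1 / (1 - α) * B -
      Real.sqrt (N k) * (1 / (1 - α) * excessBias P κ h (M k) v) =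
      1 / (1 - α) * (A - B) - Real.sqrt (N k) * (G - c) := by
    rw [hG, hC, hbias]
    field_simp
    ring
  have hrem : |Real.sqrt (N k) * (G - c)| ≤
      |1 / (1 - α) * (s * (Real.sqrt (N k) * (q - v)))| := by
    rw [abs_of_nonneg (mul_nonneg hsk.le (sub_nonneg.2 hle))]
    have : G - c ≤ |s / (1 - α)| * |q - v| := by linarith
    refine (mul_le_mul_of_nonneg_left this hsk.le).trans (le_of_eq ?_)
    rw [abs_mul, abs_mul, abs_mul, abs_div, abs_div, abs_one, abs_of_pos hsk]
    ring
  rw [hkey]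
  refine (abs_sub _ _).trans (le_trans ?_ (le_abs_self _))
  exact add_le_add le_rfl hrem

end CVaR

end NestedRisk

end

/-! ### The rate condition and joint validity of the two limits -/

theorem theorem3p4 {Θ Ξ Ω : Type*} [MeasurableSpace Θ] [MeasurableSpace Ξ] [MeasurableSpace Ω]
    (P : Measure Θ) [IsProbabilityMeasure P] (κ : Kernel Θ Ξ) [IsMarkovKernel κ]
    (h : Θ → Ξ → ℝ) (hh : Measurable (Function.uncurry h))
    (α : ℝ) (hα0 : 0 < α) (hα1 : α < 1)
    (hstrong : NestedRisk.StrongAssumption P κ h)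
    (f : ℝ → ℝ) (hf : NestedRisk.IsDensityOf f P (NestedRisk.meanResponse κ h))
    (hfcont : ContinuousAt f (NestedRisk.VaR P (NestedRisk.meanResponse κ h) α))
    (hfpos : 0 < f (NestedRisk.VaR P (NestedRisk.meanResponse κ h) α))
    (μ : Measure Ω) [IsProbabilityMeasure μ] (θ : ℕ → Ω → Θ) (ξ : ℕ → ℕ → Ω → Ξ)
    (hsample : NestedRisk.IsNestedSample P κ μ θ ξ)
    (N M : ℕ → ℕ) (hN : Tendsto N atTop atTop) (hM : Tendsto M atTop atTop) :
    Tendsto (fun k => (N k : ℝ) / (M k : ℝ) ^ 2) atTop (𝓝 0) ↔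
      (TendstoInDistribution
          (fun k ω => Real.sqrt (N k) * (NestedRisk.nestedVaR h θ ξ α (N k) (M k) ω -
            NestedRisk.VaR P (NestedRisk.meanResponse κ h) α))
          atTop
          (fun z : ℝ => NestedRisk.sigmaV P (NestedRisk.meanResponse κ h) f α * z)
          (fun _ => μ) (gaussianReal 0 1) ∧
        TendstoInDistribution
          (fun k ω => Real.sqrt (N k) * (NestedRisk.nestedCVaR h θ ξ α (N k) (M k) ω -
            NestedRisk.CVaR P (NestedRisk.meanResponse κ h) α))
          atTop
          (fun z : ℝ => NestedRisk.sigmaC P (NestedRisk.meanResponse κ h) α * z)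
          (fun _ => μ) (gaussianReal 0 1)) := by
  have hH := NestedRisk.measurable_meanResponse (κ := κ) hh
  obtain ⟨C, c, hc0, -, hle, hge⟩ := hstrong.exists_bias_bounds hh hf hfcont hfpos
  set v := NestedRisk.VaR P (NestedRisk.meanResponse κ h) α with hv
  have hα : 0 < 1 - α := sub_pos.2 hα1
  have hsq : ∀ k, (N k : ℝ) / (M k : ℝ) ^ 2 = (Real.sqrt (N k) / M k) ^ 2 := fun k => by
    rw [div_pow, Real.sq_sqrt (Nat.cast_nonneg _)]
  -- The deterministic bias in `√N (c̃ - c)`, nonnegative and of exact order `√N / M` once `M k` is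
  -- large.
  set a : ℕ → ℝ := fun k =>
    Real.sqrt (N k) * (1 / (1 - α) * NestedRisk.excessBias P κ h (M k) v) with ha
  have hlin := NestedRisk.tendstoInDistribution_normalizedSum hsample.measurable_block
    hsample.indep hsample.law hN
    ((NestedRisk.measurable_outerExcess (κ := κ) hh v).const_mul (1 / (1 - α)))
    ((hstrong.memLp_outerExcess hh v).const_mul (1 / (1 - α)))
  rw [hv, ← NestedRisk.sigmaC_eq hh hα1, ← hv] at hlin
  have hmeas : ∀ k, Measurable fun ω => Real.sqrt (N k) *
      (NestedRisk.nestedCVaR h θ ξ α (N k) (M k) ω -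
        NestedRisk.CVaR P (NestedRisk.meanResponse κ h) α) := fun k =>
    ((NestedRisk.measurable_cvarEstimator hα0 hα1
      (hsample.measurable_nestedMeans hh _ _)).sub_const _).const_mul _
  constructor
  · intro hNM
    have hNM' : Tendsto (fun k => Real.sqrt (N k) / M k) atTop (𝓝 0) := by
      have h1 := (Real.continuous_sqrt.tendsto 0).comp hNM
      rw [Real.sqrt_zero] at h1
      refine h1.congr fun k => ?_
      simp only [Function.comp_apply]
      rw [hsq, Real.sqrt_sq (by positivity)]
    have hV := NestedRisk.tendstoInDistribution_nestedVaR hstrong hh hsample hf hα0 hα1 hfcont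
      hfpos hN hM hNM'
    refine ⟨hV, ?_⟩
    have hR := NestedRisk.tendstoInMeasure_nestedCVaR_remainder hstrong hh hsample hf hα0 hα1
      hfcont hfpos hN hM hV
    have ha0 : Tendsto a atTop (𝓝 0) := by
      have h1 := hNM'.const_mul (1 / (1 - α) * C)
      rw [mul_zero] at h1
      refine squeeze_zero' ?_ ?_ h1
      · filter_upwards [hM.eventually_ge_atTop 1] with k hk
        have := (hle (M k) hk).1
        positivity
      · filter_upwards [hM.eventually_ge_atTop 1] with k hk
        have h2 : Real.sqrt (N k) * (1 / (1 - α) * NestedRisk.excessBias P κ h (M k) v) ≤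
            Real.sqrt (N k) * (1 / (1 - α) * (C / M k)) := by
          gcongr
          exact (hle (M k) hk).2
        refine h2.trans (le_of_eq ?_)
        ring
    refine NestedRisk.TendstoInDistribution.add_of_tendstoInMeasure_zero hlin
      (NestedRisk.tendstoInMeasure_zero_add hR
        (NestedRisk.tendstoInMeasure_zero_of_tendsto ha0))
      (fun k => (hmeas k).aemeasurable) (Eventually.of_forall fun k ω => ?_)
    ring
  · rintro ⟨hV, hCV⟩
    have hR := NestedRisk.tendstoInMeasure_nestedCVaR_remainder hstrong hh hsample hf hα0 hα1
      hfcont hfpos hN hM hV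
    -- Subtracting `a` from `√N (c̃ - c)` leaves the linear sum plus a vanishing remainder, hence
    -- the same limit law as without the subtraction.
    have ha0 : Tendsto a atTop (𝓝 0) := by
      refine NestedRisk.tendsto_zero_of_tendstoInDistribution_sub ?_ hCV
        (NestedRisk.TendstoInDistribution.add_of_tendstoInMeasure_zero hlin hR
          (fun k => ((hmeas k).sub_const _).aemeasurable) (Eventually.of_forall fun k ω => ?_))
      · filter_upwards [hM.eventually_ge_atTop 1] with k hk
        have := (hle (M k) hk).1
        positivity
      · ring
    have hNM' : Tendsto (fun k => Real.sqrt (N k) / M k) atTop (𝓝 0) := by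
      -- The factor inverts the lower bound `a k ≥ √N * c / ((1 - α) * M)`.
      have h1 := ha0.const_mul ((1 - α) / c)
      rw [mul_zero] at h1
      refine squeeze_zero' (Eventually.of_forall fun k => by positivity) ?_ h1
      filter_upwards [hM.eventually hge] with k hk
      have h2 : Real.sqrt (N k) * (1 / (1 - α) * (c / M k)) ≤ a k := by
        change _ ≤ Real.sqrt (N k) * (1 / (1 - α) * NestedRisk.excessBias P κ h (M k) v)
        gcongr
      refine le_trans (le_of_eq ?_) (mul_le_mul_of_nonneg_left h2 (by positivity))
      field_simp
    have h3 := hNM'.pow 2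
    rw [zero_pow two_ne_zero] at h3
    exact h3.congr fun k => (hsq k).symm
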